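/- **The automaton.** Let $A=\{0,1,2,3,E\}$ and let $F=F_d\circ F_p$ on $A^{\mathbb Z}$. Here $F_p$ replaces by $0$ every $E$ that has another $E$ at distance at most $3$. $F_d$ fixes every $E$, and replaces a digit $x_i\in\{0,1,2,3\}$ by $$x_i-2\cdot 1_{\{2,3\}}(x_i)+1_{\{2,3\}}(x_{i-1})+1_{E}(x_{i-1})\bigl(1+1_{\{2\}}(x_{i-2})\bigr).$$ **Counters.** Let $\Omega$ be the set of $x\in A^{\mathbb Z}$ with infinitely many $E$'s in both directions and at least three digits between any two $E$'s. For $x\in\Omega$ let $\dots<s_{-1}<s_0\le 0<s_1<\dots$ be the positions of the $E$'s, and put $l_i=s_{i+1}-s_i-1$, $d_i=\sum_{s_i<j<s_{i+1}}x_j2^{\,j-s_i-1}$, $c_i=d_i \bmod 2^{l_i}$. Put $r_i=l_i+1-\max\{j\in(s_i,s_{i+1}):x_j>1\}+s_i$ if $d_i\ge 2^{l_i}$, and $r_i=0$ otherwise. Let $\varphi(x)=(l_i,c_i,r_i)_{i\in\mathbb Z}$. For $k\ge0$ let $\Omega^*_k$ be the set of $x\in\Omega\cap\{0,1,E\}^{\mathbb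 Z}$ with $s_0(x)=-k$; $\varphi$ is injective on each $\Omega^*_k$. **The measures.** Let $\nu_*(k)=(2/3)^k/\sum_{j\ge3}(2/3)^j$ for $k\ge 3$ and $\nu_*(k)=0$ for $k<3$; let $\bar l=\sum_k k\,\nu_*(k)$ and $\nu=\nu_*^{\otimes\mathbb Z}$. For $l\in\mathbb N^{\mathbb Z}$ let $\mu^H_l=\bigotimes_{i}\bigl(\delta_{l_i}\otimes m_{2^{l_i}}\otimes\delta_0\bigr)$, where $m_L$ is the uniform measure on $\{0,\dots,L-1\}$. For $e\in\{0,1\}$ put $$\tilde\mu^F(I)=\frac1{\bar l+e}\int\sum_{k=0}^{l_0+e-1}\mu^H_l\bigl(\varphi(I\cap\Omega^*_k)\bigr)\,\nu(dl).$$ ($e=1$ distributes the mass over all $l_0+1$ sites of a block consisting of an $E$ and the $l_0$ digits that follow it; $e=0$ omits the last site.) A measure $\mu^F$ is any probability measure that is the weak limit, along some strictly increasing sequence $(n_j)$, of the Cesàro means $\frac1{n_j}\sum_{k=0}^{n_j-1}\tilde\mu^F\circ F^{-k}$. **Exponents.** For $x\in A^{\mathbb Z}$ let $W_s^+(x)=\{y: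 y_i=x_i\ \forall i\ge s\}$ and $W_s^-(x)=\{y: y_i=x_i\ \forall i\le s\}$. Let $$I_n^{\pm}(x)=\min\{s\in\mathbb N:\ F^i(W^\pm_{\mp s}(x))\subset W_0^\pm(F^i(x))\ \text{ for } 1\le i\le n\},\qquad I^\pm_\mu=\liminf_{n\to\infty}\frac1n\int I_n^\pm\,d\mu .$$ Let $t_F(n)(x)=\min\{s:\exists y\in W^+_{-n}(x),\ F^s(y)\notin W_0^+(F^s(x))\}\in\mathbb N\cup\{\infty\}$ be the time a perturbation needs to cross $n$ sites. **Proposition.** Let $e\in\{0,1\}$. Measures $\mu^F$ exist, and there are constants $c>0$ and $\delta>1$ such that every $\mu^F$ satisfies the following. 1. The average Lyapunov exponents vanish: $I^+_{\mu^F}+I^-_{\mu^F}=0$. 2. With $\mu^F$-probability tending to $1$ as $n\to\infty$, we have $x\in\Omega$, $l_0(x)\le 2\ln n$, there is a large counter to the left, that is, an $i<0$ with $\sum_{j=i}^{0}l_j(x)\le n$, $l_i(x)\ge 2\ln n$ and $c_i(x)\le 2^{l_i(x)}-2^{1.5\ln n}$, and moreover $t_F(n)(x)\ge c\,n^{\delta}$.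 -/

import Mathlib

open MeasureTheory Filter Topology
open scoped ENNReal

/-! ### Perturbations, average Lyapunov exponents and crossing times -/

namespace CellularLyapunov

variable {A : Type*}

/-- `W⁺_s(x)`: the configurations that agree with `x` on `[s, ∞)`. -/
def rightSet (s : ℤ) (x : ℤ → A) : Set (ℤ → A) := {y | ∀ i, s ≤ i → y i = x i}

/-- `W⁻_s(x)`: the configurations that agree with `x` on `(-∞, s]`. -/
def leftSet (s : ℤ) (x : ℤ → A) : Set (ℤ → A) := {y | ∀ i, i ≤ s → y i = x i}

/-- `I⁺_n(x) = min {s ∈ ℕ : ∀ 1 ≤ i ≤ n, Fⁱ(W⁺_{-s}(x)) ⊆ W⁺_0(Fⁱ(x))}`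
(it would be `⊤` if there were no such `s`). -/
noncomputable def speedPlus (F : (ℤ → A) → (ℤ → A)) (n : ℕ) (x : ℤ → A) : ℕ∞ :=
  ⨅ (s : ℕ) (_ : ∀ i : ℕ, 1 ≤ i → i ≤ n →
    F^[i] '' rightSet (-(s : ℤ)) x ⊆ rightSet 0 (F^[i] x)), (s : ℕ∞)

/-- `I⁻_n(x) = min {s ∈ ℕ : ∀ 1 ≤ i ≤ n, Fⁱ(W⁻_s(x)) ⊆ W⁻_0(Fⁱ(x))}`
(it would be `⊤` if there were no such `s`). -/
noncomputable def speedMinus (F : (ℤ → A) → (ℤ → A)) (n : ℕ) (x : ℤ → A) : ℕ∞ :=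
  ⨅ (s : ℕ) (_ : ∀ i : ℕ, 1 ≤ i → i ≤ n →
    F^[i] '' leftSet (s : ℤ) x ⊆ leftSet 0 (F^[i] x)), (s : ℕ∞)

/-- The average Lyapunov exponent `I⁺_μ = liminf (1/n) ∫ I⁺_n dμ`, with values in `[0, ∞]`. -/
noncomputable def avgPlus [MeasurableSpace A] (F : (ℤ → A) → (ℤ → A))
    (μ : Measure (ℤ → A)) : ℝ≥0∞ :=
  liminf (fun n : ℕ => (∫⁻ x, (speedPlus F n x : ℝ≥0∞) ∂μ) / (n : ℝ≥0∞)) atTop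

/-- The average Lyapunov exponent `I⁻_μ = liminf (1/n) ∫ I⁻_n dμ`, with values in `[0, ∞]`. -/
noncomputable def avgMinus [MeasurableSpace A] (F : (ℤ → A) → (ℤ → A))
    (μ : Measure (ℤ → A)) : ℝ≥0∞ :=
  liminf (fun n : ℕ => (∫⁻ x, (speedMinus F n x : ℝ≥0∞) ∂μ) / (n : ℝ≥0∞)) atTop

/-- `t_F(n)(x)`: the least time at which some perturbation of `x` strictly to the left of `-n`
is visible on `[0, ∞)`; it is `⊤` if there is no such time. -/
noncomputable def crossTime (F : (ℤ → A) → (ℤ → A)) (n : ℕ) (x : ℤ → A) : ℕ∞ :=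
  ⨅ (s : ℕ) (_ : ∃ y ∈ rightSet (-(n : ℤ)) x, F^[s] y ∉ rightSet 0 (F^[s] x)), (s : ℕ∞)

end CellularLyapunov

/-! ### The automaton -/

namespace CounterCA

/-- The alphabet `{0, 1, 2, 3, E}`. -/
inductive Letter
  | digit (d : Fin 4)
  | emitter
  deriving DecidableEq

instance : TopologicalSpace Letter := ⊥
instance : DiscreteTopology Letter := ⟨rfl⟩
instance : MeasurableSpace Letter := ⊤

namespace Letter

/-- The numerical value of a digit (`0` for the emitter). -/
def val : Letter → ℕ
  | digit d => d
  | emitter => 0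

/-- The digit with value `n`; it is used only for `n ≤ 3`. -/
def ofNat (n : ℕ) : Letter := digit (Fin.ofNat 4 n)

end Letter

open Letter

/-- Bi-infinite configurations, with the product topology and its Borel σ-algebra. -/
abbrev Config := ℤ → Letter

/-- The local rule of `F_d`, applied to `(x_{i-2}, x_{i-1}, x_i) = (a, b, c)`. Every sum below is
at most `3`, because `b` is not both an emitter and one of the digits `2`, `3`. -/
def localD (a b c : Letter) : Letter :=
  if c = emitter then emitter
  else ofNat (c.val - 2 * (if 2 ≤ c.val then 1 else 0) + (if 2 ≤ b.val then 1 else 0)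
    + (if b = emitter then 1 + (if a.val = 2 then 1 else 0) else 0))

/-- The automaton `F_d`. -/
def mapD (x : Config) : Config := fun i => localD (x (i - 2)) (x (i - 1)) (x i)

/-- The automaton `F_p`: an emitter with another emitter at distance at most `3` becomes `0`. -/
def mapP (x : Config) : Config := fun i =>
  if x i = emitter ∧ ∃ j ∈ ({-3, -2, -1, 1, 2, 3} : Finset ℤ), x (i + j) = emitter then ofNat 0
  else x i

/-- The automaton `F = F_d ∘ F_p`. -/
def F : Config → Config := mapD ∘ mapP

/-! ### Counters -/

/-- Configurations with infinitely many emitters in both directions and at least three digits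
between any two of them. -/
def Omega : Set Config :=
  {x | (∀ N : ℤ, ∃ i ≥ N, x i = emitter) ∧ (∀ N : ℤ, ∃ i ≤ N, x i = emitter) ∧
    ∀ i j : ℤ, x i = emitter → x j = emitter → i < j → i + 4 ≤ j}

/-- `s_0, s_1, s_2, …`: the last emitter at or before the origin, then the next ones. -/
noncomputable def posRight (x : Config) : ℕ → ℤ
  | 0 => sSup {i : ℤ | i ≤ 0 ∧ x i = emitter}
  | n + 1 => sInf {i : ℤ | posRight x n < i ∧ x i = emitter}

/-- `s_0, s_{-1}, s_{-2}, …`. -/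
noncomputable def posLeft (x : Config) : ℕ → ℤ
  | 0 => posRight x 0
  | n + 1 => sSup {i : ℤ | i < posLeft x n ∧ x i = emitter}

/-- The position `s_j(x)` of the `j`-th emitter. -/
noncomputable def pos (x : Config) (j : ℤ) : ℤ :=
  if 0 ≤ j then posRight x j.toNat else posLeft x (-j).toNat

/-- `l_i(x) = s_{i+1}(x) - s_i(x) - 1`. -/
noncomputable def len (x : Config) (i : ℤ) : ℕ := (pos x (i + 1) - pos x i - 1).toNat

/-- `d_i(x) = ∑ x_j 2^(j - s_i - 1)`, the sum being over `s_i < j < s_{i+1}`. -/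
noncomputable def total (x : Config) (i : ℤ) : ℕ :=
  ∑ j ∈ Finset.Ioo (pos x i) (pos x (i + 1)), (x j).val * 2 ^ (j - pos x i - 1).toNat

/-- The state `c_i(x)` of the `i`-th counter. -/
noncomputable def state (x : Config) (i : ℤ) : ℕ := total x i % 2 ^ len x i

/-- The overflow position `r_i(x)`. -/
noncomputable def overflow (x : Config) (i : ℤ) : ℕ :=
  if 2 ^ len x i ≤ total x i then
    ((len x i : ℤ) + 1 - sSup {j : ℤ | pos x i < j ∧ j < pos x (i + 1) ∧ 1 < (x j).val}
      + pos x i).toNat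
  else 0

/-- Bi-infinite sequences of counters `(l_i, c_i, r_i)`. -/
abbrev Counters := ℤ → ℕ × ℕ × ℕ

/-- The projection `φ`. -/
noncomputable def phi (x : Config) : Counters := fun i => (len x i, state x i, overflow x i)

/-- The points of `Ω` with letters in `{0, 1, E}` for which the last emitter at or before the
origin is at `-k`. For `k = 0` this is `Ω* = Ω ∩ {x ∈ {0, 1, E}^ℤ : x_0 = E}`, and in general it is
`σ^k {x ∈ Ω* : k ≤ l_0(x)}`, where `(σ x)_i = x_{i+1}`: the `k`-th level of the tower over `Ω*`. -/
def OmegaStar (k : ℕ) : Set Config :=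
  {x | x ∈ Omega ∧ (∀ i, x i = emitter ∨ x i = ofNat 0 ∨ x i = ofNat 1) ∧ pos x 0 = -(k : ℤ)}

/-! ### The measures -/

/-- The geometric law with ratio `2/3` conditioned to be at least `3`. -/
noncomputable def lengthLaw : PMF ℕ :=
  PMF.normalize (fun k => if 3 ≤ k then (2 / 3 : ℝ≥0∞) ^ k else 0)
    (by
      intro h
      have h3 := ENNReal.tsum_eq_zero.1 h 3
      simp at h3)
    (by
      refine ne_top_of_le_ne_top ?_
        (ENNReal.tsum_le_tsum (g := fun k => (2 / 3 : ℝ≥0∞) ^ k) (fun k => ?_))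
      · rw [ENNReal.tsum_geometric]
        refine ENNReal.inv_ne_top.2 (tsub_pos_of_lt ?_).ne'
        rw [ENNReal.div_lt_iff] <;> norm_num
      · split_ifs <;> simp)

/-- The mean `∑ k ν_*(k)` of the length of a counter. -/
noncomputable def meanLength : ℝ≥0∞ := ∑' k : ℕ, lengthLaw k * k

/-- The product law `ν = ν_*^{⊗ℤ}` of the lengths. -/
noncomputable def lengthsLaw : Measure (ℤ → ℕ) :=
  Measure.infinitePi (fun _ : ℤ => lengthLaw.toMeasure)

/-- The uniform measure `m_{2^l}` on `{0, …, 2^l - 1}`. -/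
noncomputable def uniformState (l : ℕ) : Measure ℕ :=
  (PMF.uniformOfFinset (Finset.range (2 ^ l))
    (Finset.nonempty_range_iff.2 (pow_ne_zero l two_ne_zero))).toMeasure

instance (l : ℕ) : IsProbabilityMeasure (uniformState l) := by
  unfold uniformState; infer_instance

/-- `μ^H_l = ⊗_i (δ_{l_i} ⊗ m_{2^{l_i}} ⊗ δ_0)`. -/
noncomputable def muH (l : ℤ → ℕ) : Measure Counters :=
  Measure.infinitePi (fun i : ℤ =>
    (Measure.dirac (l i)).prod ((uniformState (l i)).prod (Measure.dirac 0)))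

/-- The measure `I ↦ ∑_{0 ≤ k < l_0 + e} μ^H_l (φ (I ∩ Ω*_k))`. For `e = 1` the sum runs over all
`l_0 + 1` sites of the block formed by an emitter and the `l_0` digits after it, which is what makes
the mixture below shift-invariant; for `e = 0` the last site is left out. The map `φ` is injective on each
`Ω*_k`, and `comap` is the measure `J ↦ μ^H_l (φ (J))` on the subsets of `Ω*_k`. -/
noncomputable def muTower (e : ℕ) (l : ℤ → ℕ) : Measure Config :=
  ∑ k ∈ Finset.range (l 0 + e),
    ((muH l).comap (fun x : OmegaStar k => phi x.1)).map Subtype.val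

/-- The measure `μ̃^F`: the mixture of the tower measures, normalized. -/
noncomputable def muTilde (e : ℕ) : Measure Config :=
  (meanLength + e)⁻¹ • lengthsLaw.bind (muTower e)

/-- The Cesàro means `(1/n) ∑_{k<n} μ̃^F ∘ F^{-k}`. -/
noncomputable def cesaro (e n : ℕ) : Measure Config :=
  (n : ℝ≥0∞)⁻¹ • ∑ k ∈ Finset.range n, (muTilde e).map F^[k]

/-- `μ` is an invariant measure `μ^F` produced by the construction: a probability measure which
is the weak limit of the Cesàro means along some subsequence. -/
def IsMuF (e : ℕ) (μ : Measure Config) : Prop :=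
  IsProbabilityMeasure μ ∧ ∃ m : ℕ → ℕ, StrictMono m ∧
    ∀ f : C(Config, ℝ),
      Tendsto (fun j => ∫ x, f x ∂(cesaro e (m j))) atTop (𝓝 (∫ x, f x ∂μ))

/-- The configurations in `Ω` with `l_0 ≤ 2 ln n` that have a large counter `i < 0` to the left,
inside the `n` sites considered, whose state is far from its maximum. -/
def slowSet (n : ℕ) : Set Config :=
  {x | x ∈ Omega ∧ (len x 0 : ℝ) ≤ 2 * Real.log n ∧ ∃ i : ℤ, i < 0 ∧
    ∑ j ∈ Finset.Icc i 0, len x j ≤ n ∧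
    2 * Real.log n ≤ len x i ∧
    (state x i : ℝ) ≤ 2 ^ len x i - 2 ^ (1.5 * Real.log n)}

end CounterCA

/-!
Away from its first step `F` acts on configurations whose emitters are at least four sites apart.
It then fixes the emitters and carries information to the right only, so perturbations coming from
the right advance by at most three sites in total (`speedMinus_le`). For perturbations coming from
the left, a block of `L` digits between two emitters is a binary counter: what enters on its left
is either stored or leaves as a carry on its right (`block_mapD`), at most two units enter per step,
and nothing leaves before the stored number reaches `2 ^ L`. A perturbation is therefore stopped by
a counter which is `2 M` below its maximum during at least `M` steps (`le_crossTime`).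

It remains to find such a counter, of length `K = ⌈2 ln n⌉` and with `M ≥ 2 ^ (1.5 ln n) = n ^ δ`,
`δ = 1.5 ln 2 > 1`, among the `n` sites on the left of the origin, with a probability which tends to
`1` uniformly in the age of the configuration. There are two points.

* Lengths do not change in time. The frequency of the length `K` is at least of order `n ^ (-0.84)`,
  so one of the first `n ^ 0.9` counters on the left has this length, and these counters occupy
  `o(n)` sites by Markov's inequality (`tendsto_badLengths`). The size bias of the counter at the
  origin is harmless because its density is integrable.
* States do change, but they stay uniform given the lengths: up to at most `2 K` units
  which are still on their way, the content of a counter at time `t` is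
  `(initial state + incoming flux) mod 2 ^ K` (`block_iterate_le_mod`), and the flux depends only on
  the counters further left. Averaging over the rotations of the initial state, a law-preserving
  operation, shows that the counter is within `2 M` of its maximum with probability at most
  `(2 M + 2 K) / 2 ^ K → 0` (`card_rotate_le`, `muH_block_le`).

The resulting event is clopen, so its bound passes to the weak limits `μ^F` (`IsMuF.le`); they
are carried by `Ω` because `F` does not move emitters (`IsMuF.ae_omega`), and they exist by
compactness of the space of probability measures (`exists_isMuF`). Finally, in `m = M - 1` steps,
much more than `n`, perturbations cross at most `n` sites except on an event of small probability,
where they cross at most `2 m + 3`; hence `I⁺ = 0` along this sequence of times.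
To evaluate the measures, `decode` inverts the projection `φ` on each level of the
tower (`map_comap_phi`).
-/

namespace CounterCA

open Letter CellularLyapunov

/-! ### Dynamics of configurations with separated emitters -/

/-- Configurations with at least three digits between any two emitters. -/
def Spaced : Set Config :=
  {x | ∀ i j : ℤ, x i = emitter → x j = emitter → i < j → i + 4 ≤ j}

/-- The carry sent by site `i` to site `i + 1` under one step of `F_d`. -/
def carry (x : Config) (i : ℤ) : ℕ :=
  (if 2 ≤ (x i).val then 1 else 0) +
    (if x i = emitter then 1 + (if (x (i - 1)).val = 2 then 1 else 0) else 0)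

/-- The number represented by the `L` letters to the right of site `s`, least digit first. -/
def block (s : ℤ) (L : ℕ) (x : Config) : ℕ :=
  ∑ j ∈ Finset.range L, (x (s + 1 + j)).val * 2 ^ j

lemma localD_eq_emitter {a b c : Letter} : localD a b c = emitter ↔ c = emitter := by
  unfold localD
  split_ifs <;> simp_all [Letter.ofNat]

lemma localD_val : ∀ a b c : Letter, c ≠ emitter →
    (localD a b c).val + 2 * (if 2 ≤ c.val then 1 else 0) =
      c.val + ((if 2 ≤ b.val then 1 else 0)
        + (if b = emitter then 1 + (if a.val = 2 then 1 else 0) else 0)) := by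
  rintro (a | _) (b | _) (c | _) hc
  · revert a b c; decide
  · exact absurd rfl hc
  · revert a c; decide
  · exact absurd rfl hc
  · revert b c; decide
  · exact absurd rfl hc
  · revert c; decide
  · exact absurd rfl hc

lemma Letter.val_le_three (a : Letter) : a.val ≤ 3 := by
  rcases a with a | _
  · revert a; decide
  · decide

lemma carry_le_two (x : Config) (i : ℤ) : carry x i ≤ 2 := by
  unfold carry
  by_cases h : x i = emitter
  · rw [if_pos h, h, if_neg (by decide)]; split_ifs <;> omega
  · rw [if_neg h]; split_ifs <;> omega

lemma carry_of_ne {x : Config} {i : ℤ} (h : x i ≠ emitter) :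
    carry x i = if 2 ≤ (x i).val then 1 else 0 := by
  simp [carry, h]

lemma mapD_eq_emitter {x : Config} {i : ℤ} : mapD x i = emitter ↔ x i = emitter :=
  localD_eq_emitter

lemma mapD_val {x : Config} {i : ℤ} (h : x i ≠ emitter) :
    (mapD x i).val + 2 * carry x i = (x i).val + carry x (i - 1) := by
  have := localD_val (x (i - 2)) (x (i - 1)) (x i) h
  rw [carry_of_ne h, carry, show i - 1 - 1 = i - 2 by ring]
  exact this

lemma mapP_of_spaced {x : Config} (hx : x ∈ Spaced) : mapP x = x := by
  funext i
  unfold mapP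
  rw [if_neg]
  rintro ⟨hi, j, hj, hij⟩
  have h1 := hx i (i + j) hi hij
  have h2 := hx (i + j) i hij hi
  simp only [Finset.mem_insert, Finset.mem_singleton] at hj
  omega

lemma mapP_eq_emitter {x : Config} {i : ℤ} : mapP x i = emitter ↔
    x i = emitter ∧ ∀ j ∈ ({-3, -2, -1, 1, 2, 3} : Finset ℤ), x (i + j) ≠ emitter := by
  unfold mapP
  split_ifs with h
  · obtain ⟨hi, j, hj, hij⟩ := h
    simp only [Letter.ofNat, reduceCtorEq, false_iff, not_and]
    exact fun _ h => h j hj hij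
  · simp only [not_and, not_exists] at h
    exact ⟨fun hi => ⟨hi, h hi⟩, fun hi => hi.1⟩

lemma mapP_spaced (x : Config) : mapP x ∈ Spaced := by
  intro i j hi hj hij
  by_contra hlt
  rw [mapP_eq_emitter] at hi hj
  have hmem : j - i ∈ ({-3, -2, -1, 1, 2, 3} : Finset ℤ) := by
    simp only [Finset.mem_insert, Finset.mem_singleton]; omega
  exact hi.2 _ hmem (by rw [add_sub_cancel]; exact hj.1)

lemma mapD_spaced {x : Config} (hx : x ∈ Spaced) : mapD x ∈ Spaced := fun i j hi hj =>
  hx i j (mapD_eq_emitter.1 hi) (mapD_eq_emitter.1 hj)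

/-- Whatever the configuration, its image has separated emitters, so that `F_p` acts at the first
step only. -/
lemma F_spaced (x : Config) : F x ∈ Spaced := mapD_spaced (mapP_spaced x)

lemma F_of_spaced {x : Config} (hx : x ∈ Spaced) : F x = mapD x := by
  simp [F, mapP_of_spaced hx]

lemma iterate_F_spaced {x : Config} (hx : x ∈ Spaced) (n : ℕ) : F^[n] x ∈ Spaced := by
  cases n with
  | zero => exact hx
  | succ n => rw [Function.iterate_succ_apply']; exact F_spaced _

lemma iterate_F_mapP (x : Config) (n : ℕ) : F^[n + 1] x = F^[n + 1] (mapP x) := by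
  rw [Function.iterate_succ_apply, Function.iterate_succ_apply, F_of_spaced (mapP_spaced x)]
  rfl

lemma iterate_F_eq_emitter {x : Config} (hx : x ∈ Spaced) (n : ℕ) (i : ℤ) :
    F^[n] x i = emitter ↔ x i = emitter := by
  induction n with
  | zero => rfl
  | succ n ih =>
    rw [Function.iterate_succ_apply', F_of_spaced (iterate_F_spaced hx n), mapD_eq_emitter, ih]

lemma mapD_congr_left {x y : Config} {p : ℤ} (h : ∀ i ≤ p, y i = x i) :
    ∀ i ≤ p, mapD y i = mapD x i := by
  intro i hi
  simp only [mapD, h i hi, h (i - 1) (by omega), h (i - 2) (by omega)]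

/-- Once the emitters are separated, information travels to the right only. -/
lemma iterate_F_congr_left {x y : Config} (hx : x ∈ Spaced) (hy : y ∈ Spaced) {p : ℤ}
    (h : ∀ i ≤ p, y i = x i) (n : ℕ) : ∀ i ≤ p, F^[n] y i = F^[n] x i := by
  induction n with
  | zero => exact h
  | succ n ih =>
    simp only [Function.iterate_succ_apply', F_of_spaced (iterate_F_spaced hx n),
      F_of_spaced (iterate_F_spaced hy n)]
    exact mapD_congr_left ih

lemma mapP_congr {x y : Config} {i : ℤ} (h : ∀ j, i - 3 ≤ j → j ≤ i + 3 → y j = x j) :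
    mapP y i = mapP x i := by
  have : ∀ j ∈ ({-3, -2, -1, 1, 2, 3} : Finset ℤ), y (i + j) = x (i + j) := by
    intro j hj
    simp only [Finset.mem_insert, Finset.mem_singleton] at hj
    exact h _ (by omega) (by omega)
  have h0 : y i = x i := h i (by omega) (by omega)
  unfold mapP
  rw [h0]
  congr 1
  apply propext
  refine and_congr_right fun _ => exists_congr fun j => and_congr_right fun hj => ?_
  rw [this j hj]

/-! ### Propagation of perturbations -/

lemma speedMinus_le (n : ℕ) (x : Config) : speedMinus F n x ≤ 3 := by
  refine iInf₂_le_of_le 3 ?_ le_rfl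
  rintro i hi - _ ⟨y, hy, rfl⟩ j hj
  obtain ⟨i, rfl⟩ : ∃ k, i = k + 1 := ⟨i - 1, by omega⟩
  rw [iterate_F_mapP, iterate_F_mapP x]
  refine iterate_F_congr_left (mapP_spaced x) (mapP_spaced y) (p := 0) (fun k hk => ?_) _ j hj
  exact mapP_congr fun l _ hl => hy l (by push_cast; omega)

lemma iterate_F_congr_right {x y : Config} (hx : x ∈ Spaced) (hy : y ∈ Spaced) {p : ℤ}
    (h : ∀ i, p ≤ i → y i = x i) (n : ℕ) : ∀ i, p + 2 * n ≤ i → F^[n] y i = F^[n] x i := by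
  induction n with
  | zero => simpa using h
  | succ n ih =>
    intro i hi
    push_cast at hi
    simp only [Function.iterate_succ_apply', F_of_spaced (iterate_F_spaced hx n),
      F_of_spaced (iterate_F_spaced hy n), mapD, ih i (by omega), ih (i - 1) (by omega),
      ih (i - 2) (by omega)]

lemma speedPlus_le (n : ℕ) (x : Config) : speedPlus F n x ≤ (2 * n + 3 : ℕ) := by
  refine iInf₂_le_of_le (2 * n + 3) ?_ le_rfl
  rintro i hi hin _ ⟨y, hy, rfl⟩ j hj
  obtain ⟨i, rfl⟩ : ∃ k, i = k + 1 := ⟨i - 1, by omega⟩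
  rw [iterate_F_mapP, iterate_F_mapP x]
  refine iterate_F_congr_right (mapP_spaced x) (mapP_spaced y) (p := -(2 * n)) (fun k hk => ?_) _ j
    (by push_cast; omega)
  exact mapP_congr fun l hl _ => hy l (by push_cast; omega)

lemma speedPlus_le_of_lt_crossTime {n m : ℕ} {x : Config} (h : (m : ℕ∞) < crossTime F n x) :
    speedPlus F m x ≤ n := by
  refine iInf₂_le_of_le n ?_ le_rfl
  rintro i - him _ ⟨y, hy, rfl⟩
  by_contra hne
  have : crossTime F n x ≤ i := iInf₂_le_of_le i ⟨y, hy, hne⟩ le_rfl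
  exact absurd (h.trans_le this) (by simpa using him)

/-! ### Arithmetic of counters -/

/-- The conservation law of a counter: what enters at the emitter `s` is stored in the block or
leaves at its last site. -/
lemma block_mapD {x : Config} {s : ℤ} {L : ℕ} (hd : ∀ j : ℕ, j < L → x (s + 1 + j) ≠ emitter) :
    block s L (mapD x) + 2 ^ L * carry x (s + L) = block s L x + carry x s := by
  induction L with
  | zero => simp [block]
  | succ L ih =>
    have h1 := ih fun j hj => hd j (by omega)
    have h2 := mapD_val (hd L (by omega))
    rw [show s + 1 + (L : ℤ) - 1 = s + L by ring] at h2
    simp only [block, Finset.sum_range_succ] at h1 ⊢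
    rw [show s + ((L + 1 : ℕ) : ℤ) = s + 1 + L by push_cast; ring, pow_succ]
    nlinarith [h1, congrArg (· * 2 ^ L) h2]

lemma le_block {x : Config} {s : ℤ} {L j : ℕ} (hj : j < L) :
    (x (s + 1 + j)).val * 2 ^ j ≤ block s L x :=
  Finset.single_le_sum (f := fun j : ℕ => (x (s + 1 + j)).val * 2 ^ j)
    (fun _ _ => Nat.zero_le _) (Finset.mem_range.2 hj)

/-- A counter which has not reached `2 ^ L` sends no carry. -/
lemma carry_last_eq_zero {x : Config} {s : ℤ} {L : ℕ} (hL : 0 < L)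
    (hd : x (s + L) ≠ emitter) (hb : block s L x < 2 ^ L) :
    (x (s + L)).val < 2 ∧ carry x (s + L) = 0 := by
  have h1 := le_block (x := x) (s := s) (show L - 1 < L by omega)
  rw [show s + 1 + ((L - 1 : ℕ) : ℤ) = s + L by omega] at h1
  have h2 : 2 ^ L = 2 * 2 ^ (L - 1) := by rw [← pow_succ']; congr 1; omega
  have h3 : (x (s + L)).val < 2 := by
    by_contra h
    have := Nat.mul_le_mul_right (2 ^ (L - 1)) (not_lt.1 h)
    omega
  exact ⟨h3, by rw [carry_of_ne hd, if_neg (by omega)]⟩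

section Counter

variable {x : Config} {s : ℤ} {L : ℕ}

lemma block_iterate_le (hx : x ∈ Spaced) (hd : ∀ j : ℕ, j < L → x (s + 1 + j) ≠ emitter) (t : ℕ) :
    block s L (F^[t] x) ≤ block s L x + 2 * t := by
  induction t with
  | zero => simp
  | succ t ih =>
    have h := block_mapD (x := F^[t] x) (s := s) (L := L)
      (fun j hj => by rw [Ne, iterate_F_eq_emitter hx]; exact hd j hj)
    rw [Function.iterate_succ_apply', F_of_spaced (iterate_F_spaced hx t)]
    have := carry_le_two (F^[t] x) s
    omega

/-- The number of carries sent by site `i` before time `t`. -/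
def flux (x : Config) (i : ℤ) (t : ℕ) : ℕ := ∑ τ ∈ Finset.range t, carry (F^[τ] x) i

lemma flux_add_le (x : Config) (i : ℤ) (t u : ℕ) : flux x i (t + u) ≤ flux x i t + 2 * u := by
  unfold flux
  rw [Finset.sum_range_add]
  have := Finset.sum_le_card_nsmul (Finset.range u) (fun k => carry (F^[t + k] x) i) 2
    (fun k _ => carry_le_two _ _)
  simp at this
  omega

lemma block_iterate (hx : x ∈ Spaced) (hd : ∀ j : ℕ, j < L → x (s + 1 + j) ≠ emitter) (t : ℕ) :
    block s L (F^[t] x) + 2 ^ L * flux x (s + L) t = block s L x + flux x s t := by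
  induction t with
  | zero => simp [flux]
  | succ t ih =>
    have h := block_mapD (x := F^[t] x) (s := s) (L := L)
      (fun j hj => by rw [Ne, iterate_F_eq_emitter hx]; exact hd j hj)
    rw [Function.iterate_succ_apply', F_of_spaced (iterate_F_spaced hx t)]
    unfold flux at ih ⊢
    rw [Finset.sum_range_succ, Finset.sum_range_succ, Nat.mul_add]
    omega

/-- A carry crosses a block of `L` sites in at most `L` steps. -/
lemma block_add_flux_lt (hx : x ∈ Spaced) (hd : ∀ j : ℕ, j < L → x (s + 1 + j) ≠ emitter) (t : ℕ) :
    block s L x + flux x s t < 2 ^ L * (flux x (s + L) (t + L) + 1) := by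
  induction L with
  | zero => simp [block]
  | succ L ih =>
    have h1 := ih fun j hj => hd j (by omega)
    have hne := hd L (by omega)
    -- the balance of the single site `s + L + 1` at time `t + L`
    have h2 := block_iterate (L := 1) (s := s + L) hx
      (fun j hj => by
        obtain rfl : j = 0 := by omega
        rw [show s + (L : ℤ) + 1 + (0 : ℕ) = s + 1 + L by push_cast; ring]; exact hne) (t + L)
    simp only [block, Finset.sum_range_one, pow_zero, mul_one, pow_one, Nat.cast_zero, add_zero,
      Nat.cast_one] at h2
    have hne' : F^[t + L] x (s + 1 + L) ≠ emitter := by rwa [Ne, iterate_F_eq_emitter hx]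
    have h3 : flux x (s + 1 + L) (t + L + 1) =
        flux x (s + 1 + L) (t + L) + carry (F^[t + L] x) (s + 1 + L) := by
      simp [flux, Finset.sum_range_succ]
    have h4 := Letter.val_le_three (F^[t + L] x (s + 1 + L))
    rw [carry_of_ne hne'] at h3
    rw [show s + (L : ℤ) + 1 = s + 1 + L by ring] at h2
    have h5 : (x (s + 1 + L)).val + flux x (s + L) (t + L) + 1
        ≤ 2 * (flux x (s + 1 + L) (t + L + 1) + 1) := by
      split_ifs at h3 <;> omega
    rw [show s + ((L + 1 : ℕ) : ℤ) = s + 1 + L by push_cast; ring, ← add_assoc t L 1, pow_succ]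
    simp only [block, Finset.sum_range_succ] at h1 ⊢
    have h6 := Nat.mul_le_mul_left (2 ^ L) h5
    nlinarith

/-- Up to the at most `2 L` units which are still on their way, a block is a counter modulo
`2 ^ L`, driven by the flux entering on the left. -/
lemma block_iterate_le_mod (hx : x ∈ Spaced)
    (hd : ∀ j : ℕ, j < L → x (s + 1 + j) ≠ emitter) (hb : block s L x < 2 ^ L) (t : ℕ) :
    block s L (F^[t] x) ≤ (block s L x + flux x s (t - L)) % 2 ^ L + 2 * L := by
  rcases le_or_gt t L with h | h
  · have h1 := block_iterate_le hx hd t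
    rw [Nat.sub_eq_zero_of_le h]
    simp only [flux, Finset.range_zero, Finset.sum_empty, add_zero]
    rw [Nat.mod_eq_of_lt hb]
    omega
  · obtain ⟨u, rfl⟩ : ∃ u, t = u + L := ⟨t - L, by omega⟩
    have h1 := block_iterate hx hd (u + L)
    have h2 := block_add_flux_lt hx hd u
    have h3 := flux_add_le x s u L
    rw [Nat.add_sub_cancel]
    have h4 := Nat.div_add_mod (block s L x + flux x s u) (2 ^ L)
    have h5 : (block s L x + flux x s u) / 2 ^ L < flux x (s + L) (u + L) + 1 :=
      Nat.div_lt_of_lt_mul h2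
    have h6 := Nat.mul_le_mul_left (2 ^ L) (Nat.lt_succ_iff.1 h5)
    omega

/-- As long as the block has not reached `2 ^ L`, nothing on its left is visible on its right. -/
lemma le_crossTime (hx : x ∈ Spaced) (hL : 0 < L)
    (hp : x (s + L + 1) = emitter) (hd : ∀ j : ℕ, j < L → x (s + 1 + j) ≠ emitter) {n : ℕ}
    (hn : -(n : ℤ) + 3 ≤ s) (hp0 : s + L + 1 ≤ 0) {m : ℕ} (hb : block s L x + 2 * m ≤ 2 ^ L) :
    (m : ℕ∞) ≤ crossTime F n x := by
  refine le_iInf₂ fun t ht => ?_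
  obtain ⟨y, hy, hne⟩ := ht
  by_contra hlt
  replace hlt : t < m := by simpa using hlt
  apply hne
  -- from now on `z` is the perturbed configuration after the removal of close emitters
  obtain ⟨z, hz, hzx, hzy⟩ : ∃ z ∈ Spaced, (∀ i, s ≤ i → z i = x i) ∧
      ∀ i, s ≤ i → F^[t] y i = F^[t] z i := by
    have hmap : ∀ i, s ≤ i → mapP y i = x i := fun i hi => by
      rw [mapP_congr (x := x) (fun j hj _ => hy j (by omega)), mapP_of_spaced hx]
    refine ⟨mapP y, mapP_spaced y, hmap, fun i hi => ?_⟩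
    cases t with
    | zero => rw [Function.iterate_zero, id, id, hmap i hi]; exact hy i (by omega)
    | succ t => rw [iterate_F_mapP]
  have hdz : ∀ j : ℕ, j < L → z (s + 1 + j) ≠ emitter := fun j hj => by
    rw [hzx _ (by omega)]; exact hd j hj
  have hbz : block s L z = block s L x :=
    Finset.sum_congr rfl fun j _ => by rw [hzx _ (by omega)]
  have key : ∀ u ≤ t, ∀ i, s + L + 1 ≤ i → F^[u] z i = F^[u] x i := by
    intro u
    induction u with
    | zero => exact fun _ i hi => hzx i (by omega)
    | succ u ih =>
      intro hu i hi
      have ih := ih (by omega)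
      have quiet : ∀ w ∈ Spaced, (∀ j : ℕ, j < L → w (s + 1 + j) ≠ emitter) →
          block s L w = block s L x → (F^[u] w (s + L)).val < 2 := by
        intro w hw hdw hbw
        refine (carry_last_eq_zero hL ?_ ?_).1
        · rw [Ne, iterate_F_eq_emitter hw]
          have := hdw (L - 1) (by omega)
          rwa [show s + 1 + ((L - 1 : ℕ) : ℤ) = s + L by omega] at this
        · have := block_iterate_le hw hdw u
          omega
      have qx := quiet x hx hd rfl
      have qz := quiet z hz hdz hbz
      have ep : F^[u] x (s + L + 1) = emitter := (iterate_F_eq_emitter hx u _).2 hp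
      rw [Function.iterate_succ_apply', Function.iterate_succ_apply',
        F_of_spaced (iterate_F_spaced hx u), F_of_spaced (iterate_F_spaced hz u)]
      simp only [mapD]
      rcases (by omega : i = s + L + 1 ∨ i = s + L + 2 ∨ s + L + 3 ≤ i) with rfl | rfl | h3
      · rw [ih _ le_rfl, ep, localD, localD, if_pos rfl, if_pos rfl]
      · rw [ih _ hi, show s + (L : ℤ) + 2 - 1 = s + L + 1 by ring,
          show s + (L : ℤ) + 2 - 2 = s + L by ring, ih _ le_rfl, localD, localD,
          if_neg (show ¬ (F^[u] z (s + L)).val = 2 by omega),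
          if_neg (show ¬ (F^[u] x (s + L)).val = 2 by omega)]
      · rw [ih i hi, ih (i - 1) (by omega), ih (i - 2) (by omega)]
  intro i hi
  rw [hzy i (by omega), key t le_rfl i (by omega)]

end Counter

/-! ### Enumerations of the emitters -/

lemma exists_index_of_strictMono {S : ℤ → ℤ} (hS : StrictMono S) (p : ℤ) :
    ∃ i, S i ≤ p ∧ p < S (i + 1) := by
  have hup : ∀ n : ℕ, S 0 + n ≤ S n := by
    intro n
    induction n with
    | zero => simp
    | succ n ih => have := hS (show (n : ℤ) < (n + 1 : ℕ) by push_cast; omega); push_cast at *; omega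
  have hdown : ∀ n : ℕ, S (-n) ≤ S 0 - n := by
    intro n
    induction n with
    | zero => simp
    | succ n ih =>
      have := hS (show -((n + 1 : ℕ) : ℤ) < -(n : ℤ) by push_cast; omega)
      push_cast at *; omega
  obtain ⟨i, hi, hmax⟩ := Int.exists_greatest_of_bdd (P := fun i => S i ≤ p)
    ⟨(p - S 0).toNat, fun z hz => by
      by_contra h
      have h1 := hS (not_le.1 h)
      have h2 := hup (p - S 0).toNat
      omega⟩
    ⟨-((S 0 - p).toNat : ℤ), by have := hdown (S 0 - p).toNat; omega⟩
  refine ⟨i, hi, ?_⟩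
  by_contra h
  have := hmax (i + 1) (not_lt.1 h)
  omega

lemma index_unique_of_strictMono {S : ℤ → ℤ} (hS : StrictMono S) {p i j : ℤ}
    (hi : S i ≤ p ∧ p < S (i + 1)) (hj : S j ≤ p ∧ p < S (j + 1)) : i = j := by
  have h1 := hS.lt_iff_lt.1 (hi.1.trans_lt hj.2)
  have h2 := hS.lt_iff_lt.1 (hj.1.trans_lt hi.2)
  omega

open Classical in
/-- The index `i` with `S i ≤ p < S (i + 1)` (`0` if there is none). -/
noncomputable def indexOf (S : ℤ → ℤ) (p : ℤ) : ℤ :=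
  if h : ∃ i, S i ≤ p ∧ p < S (i + 1) then h.choose else 0

lemma indexOf_spec {S : ℤ → ℤ} (hS : StrictMono S) (p : ℤ) :
    S (indexOf S p) ≤ p ∧ p < S (indexOf S p + 1) := by
  unfold indexOf
  rw [dif_pos (exists_index_of_strictMono hS p)]
  exact (exists_index_of_strictMono hS p).choose_spec

lemma indexOf_eq_iff {S : ℤ → ℤ} (hS : StrictMono S) {p i : ℤ} :
    indexOf S p = i ↔ S i ≤ p ∧ p < S (i + 1) :=
  ⟨fun h => h ▸ indexOf_spec hS p, fun h => index_unique_of_strictMono hS (indexOf_spec hS p) h⟩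

lemma pos_eq_of_strictMono {x : Config} {S : ℤ → ℤ} (hS : StrictMono S)
    (hx : ∀ p, x p = emitter ↔ ∃ i, S i = p) (h0 : S 0 ≤ 0) (h1 : 0 < S 1) (i : ℤ) :
    pos x i = S i := by
  have hr : ∀ n : ℕ, posRight x n = S n := by
    intro n
    induction n with
    | zero =>
      refine IsGreatest.csSup_eq ⟨⟨h0, (hx _).2 ⟨0, rfl⟩⟩, ?_⟩
      rintro p ⟨hp, hxp⟩
      obtain ⟨i, rfl⟩ := (hx p).1 hxp
      have := hS.lt_iff_lt.1 (hp.trans_lt h1)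
      exact hS.monotone (by omega)
    | succ n ih =>
      refine IsLeast.csInf_eq ⟨⟨?_, (hx _).2 ⟨_, rfl⟩⟩, ?_⟩
      · rw [ih]; exact hS (by push_cast; omega)
      rintro p ⟨hp, hxp⟩
      obtain ⟨i, rfl⟩ := (hx p).1 hxp
      rw [ih] at hp
      have := hS.lt_iff_lt.1 hp
      exact hS.monotone (by push_cast; omega)
  have hl : ∀ n : ℕ, posLeft x n = S (-n) := by
    intro n
    induction n with
    | zero => exact hr 0
    | succ n ih =>
      refine IsGreatest.csSup_eq ⟨⟨?_, (hx _).2 ⟨_, rfl⟩⟩, ?_⟩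
      · rw [ih]; exact hS (by push_cast; omega)
      rintro p ⟨hp, hxp⟩
      obtain ⟨i, rfl⟩ := (hx p).1 hxp
      rw [ih] at hp
      have := hS.lt_iff_lt.1 hp
      exact hS.monotone (by push_cast; omega)
  unfold pos
  split_ifs with h
  · rw [hr]; congr 1; omega
  · rw [hl]; congr 1; omega

section Omega

variable {x : Config} (hx : x ∈ Omega)
include hx

lemma isGreatest_pos_zero : IsGreatest {i : ℤ | i ≤ 0 ∧ x i = emitter} (pos x 0) := by
  have hb : BddAbove {i : ℤ | i ≤ 0 ∧ x i = emitter} := ⟨0, fun i hi => hi.1⟩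
  have hne : {i : ℤ | i ≤ 0 ∧ x i = emitter}.Nonempty := hx.2.1 0
  exact ⟨Int.csSup_mem hne hb, fun i hi => le_csSup hb hi⟩

lemma isLeast_posRight (n : ℕ) :
    IsLeast {i : ℤ | posRight x n < i ∧ x i = emitter} (posRight x (n + 1)) := by
  have hb : BddBelow {i : ℤ | posRight x n < i ∧ x i = emitter} := ⟨_, fun i hi => hi.1.le⟩
  have hne : {i : ℤ | posRight x n < i ∧ x i = emitter}.Nonempty := by
    obtain ⟨i, hi, h⟩ := hx.1 (posRight x n + 1)
    exact ⟨i, by omega, h⟩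
  exact ⟨Int.csInf_mem hne hb, fun i hi => csInf_le hb hi⟩

lemma isGreatest_posLeft (n : ℕ) :
    IsGreatest {i : ℤ | i < posLeft x n ∧ x i = emitter} (posLeft x (n + 1)) := by
  have hb : BddAbove {i : ℤ | i < posLeft x n ∧ x i = emitter} := ⟨_, fun i hi => hi.1.le⟩
  have hne : {i : ℤ | i < posLeft x n ∧ x i = emitter}.Nonempty := by
    obtain ⟨i, hi, h⟩ := hx.2.1 (posLeft x n - 1)
    exact ⟨i, by omega, h⟩
  exact ⟨Int.csSup_mem hne hb, fun i hi => le_csSup hb hi⟩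

/-- Consecutive positions are emitters with no emitter between them. -/
lemma pos_step (i : ℤ) : pos x i < pos x (i + 1) ∧
    ∀ p, pos x i < p → p < pos x (i + 1) → x p ≠ emitter := by
  rcases lt_or_ge i 0 with h | h
  · obtain ⟨n, rfl⟩ : ∃ n : ℕ, i = -((n + 1 : ℕ) : ℤ) := ⟨(-i - 1).toNat, by omega⟩
    have h1 : pos x (-((n + 1 : ℕ) : ℤ)) = posLeft x (n + 1) := by
      rw [pos, if_neg (by omega)]; congr 1
    have h2 : pos x (-((n + 1 : ℕ) : ℤ) + 1) = posLeft x n := by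
      rcases Nat.eq_zero_or_pos n with rfl | hn
      · simp [pos, posLeft]
      · rw [pos, if_neg (by omega)]; congr 1; omega
    have hg := isGreatest_posLeft hx n
    rw [h1, h2]
    exact ⟨hg.1.1, fun p hp hp' hE => absurd (hg.2 ⟨hp', hE⟩) (not_le.2 hp)⟩
  · obtain ⟨n, rfl⟩ : ∃ n : ℕ, i = n := ⟨i.toNat, by omega⟩
    have h1 : pos x n = posRight x n := by rw [pos, if_pos h]; rfl
    have h2 : pos x ((n : ℤ) + 1) = posRight x (n + 1) := by
      rw [pos, if_pos (by omega)]; congr 1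
    have hg := isLeast_posRight hx n
    rw [h1, h2]
    exact ⟨hg.1.1, fun p hp hp' hE => absurd (hg.2 ⟨hp, hE⟩) (not_le.2 hp')⟩

lemma pos_strictMono : StrictMono (pos x) := strictMono_int_of_lt_succ fun i => (pos_step hx i).1

lemma apply_pos (i : ℤ) : x (pos x i) = emitter := by
  rcases lt_or_ge i 0 with h | h
  · obtain ⟨n, rfl⟩ : ∃ n : ℕ, i = -((n + 1 : ℕ) : ℤ) := ⟨(-i - 1).toNat, by omega⟩
    rw [pos, if_neg (by omega)]
    exact (isGreatest_posLeft hx n).1.2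
  · obtain ⟨n, rfl⟩ : ∃ n : ℕ, i = n := ⟨i.toNat, by omega⟩
    rw [pos, if_pos h]
    rcases n with _ | n
    · exact (isGreatest_pos_zero hx).1.2
    · exact (isLeast_posRight hx n).1.2

lemma eq_emitter_iff_pos (p : ℤ) : x p = emitter ↔ ∃ i, pos x i = p := by
  refine ⟨fun hp => ?_, fun ⟨i, hi⟩ => hi ▸ apply_pos hx i⟩
  obtain ⟨i, h1, h2⟩ := exists_index_of_strictMono (pos_strictMono hx) p
  refine ⟨i, le_antisymm h1 (not_lt.1 fun h => (pos_step hx i).2 p h h2 hp)⟩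

lemma pos_zero_le : pos x 0 ≤ 0 := (isGreatest_pos_zero hx).1.1

lemma pos_one_pos : 0 < pos x 1 := by
  by_contra h
  have := (isGreatest_pos_zero hx).2 ⟨not_lt.1 h, apply_pos hx 1⟩
  have := pos_strictMono hx (show (0 : ℤ) < 1 by norm_num)
  omega

lemma pos_add_one (i : ℤ) : pos x (i + 1) = pos x i + len x i + 1 := by
  have := (pos_step hx i).1
  unfold len
  omega

lemma three_le_len (i : ℤ) : 3 ≤ len x i := by
  have h1 := hx.2.2 _ _ (apply_pos hx i) (apply_pos hx (i + 1)) (pos_step hx i).1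
  have h2 := pos_add_one hx i
  omega

lemma total_eq_block (i : ℤ) : total x i = block (pos x i) (len x i) x := by
  have h := pos_add_one hx i
  refine (Finset.sum_nbij' (fun j : ℕ => pos x i + 1 + j) (fun p => (p - pos x i - 1).toNat)
    ?_ ?_ ?_ ?_ ?_).symm
  · intro j hj; simp only [Finset.mem_range, Finset.mem_Ioo] at *; omega
  · intro j hj; simp only [Finset.mem_range, Finset.mem_Ioo] at *; omega
  · intro j hj; simp only [Finset.mem_range] at *; omega
  · intro j hj; simp only [Finset.mem_Ioo] at *; omega
  · intro j hj
    rw [show (pos x i + 1 + (j : ℤ) - pos x i - 1).toNat = j by omega]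

end Omega

lemma Omega_subset_Spaced {x : Config} (hx : x ∈ Omega) : x ∈ Spaced := hx.2.2

/-! ### Binary expansions -/

lemma sum_bits_lt {b : ℕ → ℕ} {L : ℕ} (hb : ∀ j < L, b j ≤ 1) :
    ∑ j ∈ Finset.range L, b j * 2 ^ j < 2 ^ L := by
  induction L with
  | zero => simp
  | succ L ih =>
    rw [Finset.sum_range_succ, pow_succ]
    have := ih fun j hj => hb j (by omega)
    have := Nat.mul_le_mul_right (2 ^ L) (hb L (by omega))
    omega

lemma sum_bits_div_mod {b : ℕ → ℕ} {L m : ℕ} (hb : ∀ j < L, b j ≤ 1) (hm : m < L) :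
    (∑ j ∈ Finset.range L, b j * 2 ^ j) / 2 ^ m % 2 = b m := by
  induction L with
  | zero => omega
  | succ L ih =>
    have hb' : ∀ j < L, b j ≤ 1 := fun j hj => hb j (by omega)
    rw [Finset.sum_range_succ]
    rcases (by omega : m = L ∨ m < L) with rfl | h
    · rw [Nat.add_mul_div_right _ _ (by positivity), Nat.div_eq_of_lt (sum_bits_lt hb'), zero_add]
      exact Nat.mod_eq_of_lt (by have := hb m hm; omega)
    · obtain ⟨d, rfl⟩ : ∃ d, L = m + 1 + d := ⟨L - m - 1, by omega⟩
      rw [show b (m + 1 + d) * 2 ^ (m + 1 + d) = b (m + 1 + d) * 2 ^ d * 2 * 2 ^ m by ring,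
        Nat.add_mul_div_right _ _ (by positivity), Nat.add_mul_mod_self_right, ih hb' h]

lemma sum_div_mod_bits (c L : ℕ) :
    ∑ j ∈ Finset.range L, c / 2 ^ j % 2 * 2 ^ j = c % 2 ^ L := by
  induction L with
  | zero => simp [Nat.mod_one]
  | succ L ih => rw [Finset.sum_range_succ, ih, Nat.mod_pow_succ]; ring

/-! ### Decoding sequences of counters -/

/-- The position of the `i`-th emitter, when the lengths of the counters are `l` and the emitter
number `0` is at `-k`. -/
def site (l : ℤ → ℕ) (k : ℕ) (i : ℤ) : ℤ :=
  -k + ∑ j ∈ Finset.range i.toNat, ((l j : ℤ) + 1) -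
    ∑ j ∈ Finset.range (-i).toNat, ((l (-(j + 1)) : ℤ) + 1)

@[simp] lemma site_zero (l : ℤ → ℕ) (k : ℕ) : site l k 0 = -k := by simp [site]

lemma site_add_one (l : ℤ → ℕ) (k : ℕ) (i : ℤ) : site l k (i + 1) = site l k i + l i + 1 := by
  rcases lt_or_ge i 0 with h | h
  · obtain ⟨n, rfl⟩ : ∃ n : ℕ, i = -((n : ℤ) + 1) := ⟨(-i - 1).toNat, by omega⟩
    have h1 : (-(-((n : ℤ) + 1))).toNat = n + 1 := by omega
    have h2 : (-(-((n : ℤ) + 1) + 1)).toNat = n := by omega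
    have h3 : (-((n : ℤ) + 1)).toNat = 0 := by omega
    have h4 : (-((n : ℤ) + 1) + 1).toNat = 0 := by omega
    rw [site, site, h1, h2, h3, h4, Finset.sum_range_succ]
    ring
  · obtain ⟨n, rfl⟩ : ∃ n : ℕ, i = n := ⟨i.toNat, by omega⟩
    have h1 : (-(n : ℤ)).toNat = 0 := by omega
    have h2 : (-((n : ℤ) + 1)).toNat = 0 := by omega
    have h3 : (n : ℤ).toNat = n := by omega
    have h4 : ((n : ℤ) + 1).toNat = n + 1 := by omega
    rw [site, site, h1, h2, h3, h4, Finset.sum_range_succ]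
    ring

lemma site_strictMono (l : ℤ → ℕ) (k : ℕ) : StrictMono (site l k) :=
  strictMono_int_of_lt_succ fun i => by have := site_add_one l k i; omega

lemma eq_site {l : ℤ → ℕ} {k : ℕ} {S : ℤ → ℤ} (h0 : S 0 = -k)
    (hS : ∀ i, S (i + 1) = S i + l i + 1) : S = site l k := by
  funext i
  induction i using Int.induction_on with
  | zero => simp [h0]
  | succ i ih => rw [hS, site_add_one, ih]
  | pred i ih =>
    have h1 := hS (-i - 1)
    have h2 := site_add_one l k (-i - 1)
    rw [sub_add_cancel] at h1 h2
    omega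

/-- The lengths of a sequence of counters. -/
def lengths (z : Counters) (i : ℤ) : ℕ := (z i).1

/-- The letter at `p`, when `p` belongs to the `i`-th counter of `z` or is its emitter. -/
def letterAt (k : ℕ) (p i : ℤ) (z : Counters) : Letter :=
  if site (lengths z) k i = p then emitter
  else ofNat ((z i).2.1 / 2 ^ (p - site (lengths z) k i - 1).toNat % 2)

/-- The configuration in `{0, 1, E}^ℤ` with counters `z` and emitter number `0` at `-k`. -/
noncomputable def decode (k : ℕ) (z : Counters) : Config := fun p =>
  letterAt k p (indexOf (site (lengths z) k) p) z

/-- The sequences of counters of the points of `Ω*_k`. -/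
def Valid (k : ℕ) : Set Counters :=
  {z | (∀ i, 3 ≤ (z i).1 ∧ (z i).2.1 < 2 ^ (z i).1 ∧ (z i).2.2 = 0) ∧ k ≤ (z 0).1}

lemma decode_eq_emitter {k : ℕ} {z : Counters} {p : ℤ} :
    decode k z p = emitter ↔ ∃ i, site (lengths z) k i = p := by
  have hS := site_strictMono (lengths z) k
  constructor
  · intro h
    by_contra hne
    simp only [not_exists] at hne
    simp [decode, letterAt, hne, Letter.ofNat] at h
  · rintro ⟨i, rfl⟩
    have : indexOf (site (lengths z) k) (site (lengths z) k i) = i :=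
      (indexOf_eq_iff hS).2 ⟨le_rfl, hS (by omega)⟩
    simp [decode, letterAt, this]

lemma decode_digit {k : ℕ} {z : Counters} {i : ℤ} {j : ℕ} (hj : j < (z i).1) :
    decode k z (site (lengths z) k i + 1 + j) = ofNat ((z i).2.1 / 2 ^ j % 2) := by
  have hS := site_strictMono (lengths z) k
  have h1 := site_add_one (lengths z) k i
  have : indexOf (site (lengths z) k) (site (lengths z) k i + 1 + j) = i :=
    (indexOf_eq_iff hS).2 ⟨by omega, by simp only [lengths] at *; omega⟩
  simp only [decode, letterAt, this]
  rw [if_neg (by omega)]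
  congr 4
  omega

lemma decode_digit_or {k : ℕ} {z : Counters} (p : ℤ) :
    decode k z p = emitter ∨ decode k z p = ofNat 0 ∨ decode k z p = ofNat 1 := by
  simp only [decode, letterAt]
  split_ifs with h
  · exact Or.inl rfl
  · right
    exact (Nat.mod_two_eq_zero_or_one _).imp (fun h => by rw [h]) (fun h => by rw [h])

lemma block_decode {k : ℕ} {z : Counters} {i : ℤ} (hz : (z i).2.1 < 2 ^ (z i).1) :
    block (site (lengths z) k i) (z i).1 (decode k z) = (z i).2.1 := by
  rw [← Nat.mod_eq_of_lt hz, ← sum_div_mod_bits]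
  refine Finset.sum_congr rfl fun j hj => ?_
  rw [decode_digit (Finset.mem_range.1 hj)]
  congr 1
  rcases Nat.mod_two_eq_zero_or_one ((z i).2.1 / 2 ^ j) with h | h <;> rw [h] <;> rfl

lemma block_lt_of_digits {x : Config} (h01 : ∀ i, x i = emitter ∨ x i = ofNat 0 ∨ x i = ofNat 1)
    (s : ℤ) (L : ℕ) : block s L x < 2 ^ L := by
  refine sum_bits_lt fun j _ => ?_
  rcases h01 (s + 1 + j) with h | h | h <;> rw [h] <;> decide

lemma decode_spaced {k : ℕ} {z : Counters} (hz : ∀ i, 3 ≤ (z i).1) : decode k z ∈ Spaced := by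
  intro p q hp hq hpq
  obtain ⟨i, rfl⟩ := decode_eq_emitter.1 hp
  obtain ⟨j, rfl⟩ := decode_eq_emitter.1 hq
  have hS := site_strictMono (lengths z) k
  have hij := hS.lt_iff_lt.1 hpq
  have h1 := hS.monotone (show i + 1 ≤ j by omega)
  have h2 := site_add_one (lengths z) k i
  have h3 := hz i
  simp only [lengths] at *
  omega

lemma decode_omega {k : ℕ} {z : Counters} (hz : ∀ i, 3 ≤ (z i).1) : decode k z ∈ Omega := by
  have hS := site_strictMono (lengths z) k
  refine ⟨fun N => ?_, fun N => ?_, decode_spaced hz⟩ <;>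
    obtain ⟨i, hi⟩ := exists_index_of_strictMono hS N
  · exact ⟨_, hi.2.le, decode_eq_emitter.2 ⟨_, rfl⟩⟩
  · exact ⟨_, hi.1, decode_eq_emitter.2 ⟨_, rfl⟩⟩

lemma pos_decode {k : ℕ} {z : Counters} (hk : k ≤ (z 0).1) (i : ℤ) :
    pos (decode k z) i = site (lengths z) k i := by
  refine pos_eq_of_strictMono (site_strictMono _ _) (fun p => decode_eq_emitter) (by simp) ?_ i
  have := site_add_one (lengths z) k 0
  simp only [zero_add, site_zero, lengths] at *
  omega

lemma decode_mem_omegaStar {k : ℕ} {z : Counters} (hz : z ∈ Valid k) :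
    decode k z ∈ OmegaStar k :=
  ⟨decode_omega fun i => (hz.1 i).1, decode_digit_or, by rw [pos_decode hz.2, site_zero]⟩

lemma phi_decode {k : ℕ} {z : Counters} (hz : z ∈ Valid k) : phi (decode k z) = z := by
  have hO : decode k z ∈ Omega := decode_omega fun i => (hz.1 i).1
  funext i
  have hlen : len (decode k z) i = (z i).1 := by
    have := site_add_one (lengths z) k i
    rw [len, pos_decode hz.2, pos_decode hz.2]
    simp only [lengths] at *
    omega
  have htot : total (decode k z) i = (z i).2.1 := by
    rw [total_eq_block hO, hlen, pos_decode hz.2, block_decode (hz.1 i).2.1]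
  have hlt := (hz.1 i).2.1
  refine Prod.ext hlen (Prod.ext ?_ ?_)
  · simp [phi, state, hlen, htot, Nat.mod_eq_of_lt hlt]
  · simp [phi, overflow, hlen, htot, hlt, (hz.1 i).2.2]

lemma phi_mem_valid {k : ℕ} {x : Config} (hx : x ∈ OmegaStar k) : phi x ∈ Valid k := by
  obtain ⟨hO, h01, h0⟩ := hx
  refine ⟨fun i => ⟨three_le_len hO i, Nat.mod_lt _ (by positivity), ?_⟩, ?_⟩
  · have : total x i < 2 ^ len x i := by
      rw [total_eq_block hO]; exact block_lt_of_digits h01 _ _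
    simp [phi, overflow, this]
  · have h1 := pos_one_pos hO
    have h2 := pos_add_one hO 0
    simp only [phi, zero_add] at *
    omega

lemma decode_phi {k : ℕ} {x : Config} (hx : x ∈ OmegaStar k) : decode k (phi x) = x := by
  obtain ⟨hO, h01, h0⟩ := hx
  have hS : pos x = site (lengths (phi x)) k := eq_site h0 (pos_add_one hO)
  funext p
  obtain ⟨i, h1, h2⟩ := exists_index_of_strictMono (pos_strictMono hO) p
  rcases h1.eq_or_lt with rfl | h
  · rw [apply_pos hO, decode_eq_emitter, ← hS]
    exact ⟨i, rfl⟩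
  · obtain ⟨j, hj⟩ : ∃ j : ℕ, p = pos x i + 1 + j := ⟨(p - pos x i - 1).toNat, by omega⟩
    have h3 := pos_add_one hO i
    have hjl : j < len x i := by omega
    have hval : ∀ j, (x (pos x i + 1 + j)).val ≤ 1 := fun j => by
      rcases h01 (pos x i + 1 + j) with h | h | h <;> rw [h] <;> decide
    have hlt := block_lt_of_digits h01 (pos x i) (len x i)
    have h4 : decode k (phi x) p = ofNat ((phi x i).2.1 / 2 ^ j % 2) := by
      rw [hj, hS]; exact decode_digit hjl
    have h5 : (phi x i).2.1 / 2 ^ j % 2 = (x p).val := by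
      simp only [phi, state]
      rw [total_eq_block hO, Nat.mod_eq_of_lt hlt, hj]
      exact sum_bits_div_mod (b := fun j : ℕ => (x (pos x i + 1 + j)).val)
        (fun j _ => hval j) hjl
    rw [h4, h5]
    have hne := (pos_step hO i).2 p h h2
    rcases h01 p with h | h | h
    · exact absurd h hne
    · rw [h]; rfl
    · rw [h]; rfl

/-! ### The law of the counters -/

/-- The law of a counter of length `L`. -/
noncomputable def counterLaw (L : ℕ) : Measure (ℕ × ℕ × ℕ) :=
  (Measure.dirac L).prod ((uniformState L).prod (Measure.dirac 0))

instance (L : ℕ) : IsProbabilityMeasure (counterLaw L) := by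
  unfold counterLaw; infer_instance

lemma muH_eq (l : ℤ → ℕ) : muH l = Measure.infinitePi fun i => counterLaw (l i) := rfl

instance (l : ℤ → ℕ) : IsProbabilityMeasure (muH l) := by
  rw [muH_eq]; infer_instance

lemma uniformState_eq_sum (L : ℕ) :
    uniformState L = (2 ^ L : ℝ≥0∞)⁻¹ • ∑ c ∈ Finset.range (2 ^ L), Measure.dirac c := by
  refine Measure.ext_of_singleton fun c => ?_
  rw [uniformState, PMF.toMeasure_apply_singleton _ _ (measurableSet_singleton c),
    PMF.uniformOfFinset_apply]
  simp only [Measure.smul_apply, Measure.finsetSum_apply, smul_eq_mul, Finset.card_range,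
    measurableSet_singleton, Measure.dirac_apply', Set.indicator_apply, Set.mem_singleton_iff,
    Pi.one_apply, Finset.sum_ite_eq']
  split_ifs <;> simp

lemma ae_counterLaw (L : ℕ) :
    ∀ᵐ a ∂counterLaw L, a.1 = L ∧ a.2.1 < 2 ^ L ∧ a.2.2 = 0 := by
  have h1 : ∀ᵐ c ∂uniformState L, c < 2 ^ L := by
    rw [uniformState_eq_sum]
    refine Measure.ae_smul_measure ?_ _
    rw [ae_iff, Measure.finsetSum_apply]
    refine Finset.sum_eq_zero fun c hc => ?_
    rw [Measure.dirac_apply' _ (MeasurableSet.of_discrete)]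
    simpa using hc
  have h2 : ∀ᵐ r ∂(Measure.dirac 0 : Measure ℕ), r = 0 := by
    rw [ae_dirac_eq]; simp
  have h3 : ∀ᵐ r ∂(Measure.dirac L : Measure ℕ), r = L := by
    rw [ae_dirac_eq]; simp
  have h4 : ∀ᵐ b ∂(uniformState L).prod (Measure.dirac 0), b.1 < 2 ^ L ∧ b.2 = 0 := by
    filter_upwards [Measure.quasiMeasurePreserving_fst.ae h1,
      Measure.quasiMeasurePreserving_snd.ae h2] with b hb hb'
    exact ⟨hb, hb'⟩
  filter_upwards [Measure.quasiMeasurePreserving_fst.ae h3,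
      Measure.quasiMeasurePreserving_snd.ae h4] with b hb hb'
  exact ⟨hb, hb'⟩

lemma ae_muH (l : ℤ → ℕ) :
    ∀ᵐ z ∂muH l, ∀ i, (z i).1 = l i ∧ (z i).2.1 < 2 ^ l i ∧ (z i).2.2 = 0 := by
  rw [ae_all_iff]
  intro i
  exact (measurePreserving_eval_infinitePi (fun i => counterLaw (l i)) i).quasiMeasurePreserving.ae
    (ae_counterLaw (l i))

lemma ae_valid {l : ℤ → ℕ} (hl : ∀ i, 3 ≤ l i) {k : ℕ} (hk : k ≤ l 0) :
    ∀ᵐ z ∂muH l, z ∈ Valid k ∧ lengths z = l := by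
  filter_upwards [ae_muH l] with z hz
  refine ⟨⟨fun i => ?_, by rw [(hz 0).1]; exact hk⟩, funext fun i => (hz i).1⟩
  obtain ⟨h1, h2, h3⟩ := hz i
  rw [h1]
  exact ⟨hl i, h2, h3⟩

/-! ### The tower measures as images -/

lemma measurable_site (k : ℕ) (i : ℤ) : Measurable fun z : Counters => site (lengths z) k i := by
  have h : ∀ j : ℤ, Measurable fun z : Counters => (lengths z j : ℤ) := fun j =>
    (measurable_of_countable fun a : ℕ × ℕ × ℕ => (a.1 : ℤ)).comp (measurable_pi_apply j)
  unfold site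
  fun_prop

lemma measurable_letterAt (k : ℕ) (p i : ℤ) : Measurable (letterAt k p i) := by
  have h : Measurable fun z : Counters => (z i).2.1 :=
    (measurable_of_countable fun a : ℕ × ℕ × ℕ => a.2.1).comp (measurable_pi_apply i)
  have h' : Measurable fun z : Counters => 2 ^ (p - site (lengths z) k i - 1).toNat :=
    (measurable_of_countable fun a : ℤ => 2 ^ (p - a - 1).toNat).comp (measurable_site k i)
  refine Measurable.ite (measurableSet_eq_fun (measurable_site k i) measurable_const)
    measurable_const ?_
  exact (measurable_of_countable fun a : ℕ => ofNat (a % 2)).comp (h.div h')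

lemma measurable_indexOf_site (k : ℕ) (p : ℤ) :
    Measurable fun z : Counters => indexOf (site (lengths z) k) p := by
  refine measurable_to_countable' fun i => ?_
  have : (fun z : Counters => indexOf (site (lengths z) k) p) ⁻¹' {i} =
      {z | site (lengths z) k i ≤ p} ∩ {z | p < site (lengths z) k (i + 1)} := by
    ext z
    exact indexOf_eq_iff (site_strictMono _ _)
  rw [this]
  exact (measurableSet_le (measurable_site k i) measurable_const).inter
    (measurableSet_lt measurable_const (measurable_site k (i + 1)))

lemma measurable_decode (k : ℕ) : Measurable (decode k) := by
  refine measurable_pi_lambda _ fun p => ?_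
  have h2 : Measurable fun q : ℤ × Counters => letterAt k p q.1 q.2 :=
    measurable_from_prod_countable_right fun i => measurable_letterAt k p i
  have h3 : Measurable fun z : Counters => (indexOf (site (lengths z) k) p, z) :=
    (measurable_indexOf_site k p).prodMk measurable_id
  have h4 := h2.comp h3
  exact h4

lemma measurableSet_valid (k : ℕ) : MeasurableSet (Valid k) := by
  have : Valid k = (⋂ i, (fun z : Counters => z i) ⁻¹'
      {a | 3 ≤ a.1 ∧ a.2.1 < 2 ^ a.1 ∧ a.2.2 = 0}) ∩ (fun z : Counters => z 0) ⁻¹' {a | k ≤ a.1} := by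
    ext z; simp [Valid]
  rw [this]
  exact (MeasurableSet.iInter fun i => measurable_pi_apply i MeasurableSet.of_discrete).inter
    (measurable_pi_apply 0 MeasurableSet.of_discrete)

/-- On a level of the tower, `φ` is injective with inverse `decode k`, so that the measure
`I ↦ μ^H_l (φ (I ∩ Ω*_k))` is the image of `μ^H_l` under `decode k`. -/
lemma map_comap_phi {l : ℤ → ℕ} (hl : ∀ i, 3 ≤ l i) {k : ℕ} (hk : k ≤ l 0) :
    ((muH l).comap (fun x : OmegaStar k => phi x.1)).map Subtype.val = (muH l).map (decode k) := by
  have hinj : Function.Injective fun x : OmegaStar k => phi x.1 := fun x y hxy =>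
    Subtype.ext <| by
      rw [← decode_phi x.2, ← decode_phi y.2]
      exact congrArg _ hxy
  have himg : ∀ B : Set Config, (fun x : OmegaStar k => phi x.1) '' (Subtype.val ⁻¹' B) =
      Valid k ∩ decode k ⁻¹' B := by
    intro B
    ext z
    constructor
    · rintro ⟨x, hx, rfl⟩
      exact ⟨phi_mem_valid x.2, by rw [Set.mem_preimage, decode_phi x.2]; exact hx⟩
    · rintro ⟨hz, hzB⟩
      exact ⟨⟨decode k z, decode_mem_omegaStar hz⟩, hzB, phi_decode hz⟩
  have hmeas : ∀ B : Set Config, MeasurableSet B → MeasurableSet (Valid k ∩ decode k ⁻¹' B) :=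
    fun B hB => (measurableSet_valid k).inter (measurable_decode k hB)
  ext B hB
  rw [Measure.map_apply measurable_subtype_coe hB, Measure.map_apply (measurable_decode k) hB,
    Measure.comap_apply _ hinj _ _ (measurable_subtype_coe hB), himg]
  · refine measure_congr ?_
    filter_upwards [ae_valid hl hk] with z hz
    apply propext
    exact and_iff_right hz.1
  · rintro s ⟨B, hB, rfl⟩
    rw [himg]
    exact hmeas B hB

lemma muTower_eq {e : ℕ} (he : e ≤ 1) {l : ℤ → ℕ} (hl : ∀ i, 3 ≤ l i) :
    muTower e l = ∑ k ∈ Finset.range (l 0 + e), (muH l).map (decode k) := by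
  refine Finset.sum_congr rfl fun k hk => map_comap_phi hl ?_
  have := Finset.mem_range.1 hk
  omega

/-! ### Measurability of the mixture -/

lemma measurable_muH : Measurable muH := by
  have hgen : (MeasurableSpace.pi : MeasurableSpace Counters) = _ :=
    (generateFrom_squareCylinders (α := fun _ : ℤ => ℕ × ℕ × ℕ)).symm
  refine Measurable.measure_of_isPiSystem_of_isProbabilityMeasure hgen
    (isPiSystem_squareCylinders (fun _ => MeasurableSpace.isPiSystem_measurableSet)
      (by simp)) ?_
  rintro s hs
  obtain ⟨I, t, ht, rfl⟩ := hs
  have : (fun l => muH l ((I : Set ℤ).pi t)) = fun l => ∏ i ∈ I, counterLaw (l i) (t i) := by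
    funext l
    exact Measure.infinitePi_pi _ fun i _ => ht i (Set.mem_univ i)
  rw [this]
  exact Finset.measurable_prod _ fun i _ =>
    (measurable_of_countable fun L => counterLaw L (t i)).comp (measurable_pi_apply i)

/-- The image form of the tower measure, for all lengths. -/
noncomputable def tower (e : ℕ) (l : ℤ → ℕ) : Measure Config :=
  ∑ k ∈ Finset.range (l 0 + e), (muH l).map (decode k)

lemma tower_apply (e : ℕ) (l : ℤ → ℕ) {B : Set Config} (hB : MeasurableSet B) :
    tower e l B = ∑ k ∈ Finset.range (l 0 + e), muH l (decode k ⁻¹' B) := by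
  rw [tower, Measure.finsetSum_apply]
  exact Finset.sum_congr rfl fun k _ => Measure.map_apply (measurable_decode k) hB

lemma measurable_tower (e : ℕ) : Measurable (tower e) := by
  refine Measure.measurable_of_measurable_coe _ fun B hB => ?_
  simp only [tower_apply e _ hB]
  have h : Measurable fun q : ℕ × (ℤ → ℕ) =>
      ∑ k ∈ Finset.range (q.1 + e), muH q.2 (decode k ⁻¹' B) :=
    measurable_from_prod_countable_right fun m =>
      Finset.measurable_sum (Finset.range (m + e)) fun k _ =>
        (Measure.measurable_coe (measurable_decode k hB)).comp measurable_muH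
  have h' : Measurable fun l : ℤ → ℕ => (l 0, l) := (measurable_pi_apply 0).prodMk measurable_id
  have h'' := h.comp h'
  exact h''

instance : IsProbabilityMeasure lengthsLaw := by unfold lengthsLaw; infer_instance

lemma measurePreserving_eval_lengthsLaw (i : ℤ) :
    MeasurePreserving (fun l : ℤ → ℕ => l i) lengthsLaw lengthLaw.toMeasure :=
  measurePreserving_eval_infinitePi (fun _ : ℤ => lengthLaw.toMeasure) i

lemma ae_three_le : ∀ᵐ l ∂lengthsLaw, ∀ i, 3 ≤ l i := by
  rw [ae_all_iff]
  intro i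
  refine (measurePreserving_eval_lengthsLaw i).quasiMeasurePreserving.ae (p := fun L => 3 ≤ L) ?_
  rw [ae_iff, PMF.toMeasure_apply_eq_zero_iff _ MeasurableSet.of_discrete,
    Set.disjoint_left]
  intro L hL
  rw [lengthLaw, PMF.mem_support_normalize_iff] at hL
  simp only [Set.mem_ofPred_eq, not_not]
  by_contra h
  exact hL (if_neg h)

/-- The mixture of the tower measures, for all measurable events. -/
lemma muTilde_apply {e : ℕ} (he : e ≤ 1) {B : Set Config} (hB : MeasurableSet B) :
    muTilde e B = (meanLength + e)⁻¹ *
      ∫⁻ l, ∑ k ∈ Finset.range (l 0 + e), muH l (decode k ⁻¹' B) ∂lengthsLaw := by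
  have hae : muTower e =ᵐ[lengthsLaw] tower e := by
    filter_upwards [ae_three_le] with l hl using muTower_eq he hl
  rw [muTilde, Measure.smul_apply, smul_eq_mul,
    Measure.bind_apply hB ⟨tower e, measurable_tower e, hae⟩]
  congr 1
  refine lintegral_congr_ae ?_
  filter_upwards [hae] with l hl
  rw [hl, tower_apply e l hB]

/-! ### Topology of the configuration space -/

instance : Finite Letter :=
  Finite.of_surjective (fun o : Option (Fin 4) => o.elim emitter digit) fun a => by
    rcases a with d | _
    exacts [⟨some d, rfl⟩, ⟨none, rfl⟩]

instance : Countable Letter := Finite.to_countable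

instance : BorelSpace Letter :=
  ⟨le_antisymm (fun _ _ => MeasurableSpace.measurableSet_generateFrom (isOpen_discrete _)) le_top⟩

lemma continuous_localD_comp {f g h : Config → Letter} (hf : Continuous f) (hg : Continuous g)
    (hh : Continuous h) : Continuous fun x => localD (f x) (g x) (h x) :=
  (continuous_of_discreteTopology (f := fun q : Letter × Letter × Letter =>
    localD q.1 q.2.1 q.2.2)).comp (hf.prodMk (hg.prodMk hh))

lemma isOpen_agree (x : Config) (N : ℕ) :
    IsOpen {y : Config | ∀ i ∈ Finset.Icc (-(N : ℤ)) N, y i = x i} := by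
  have : {y : Config | ∀ i ∈ Finset.Icc (-(N : ℤ)) N, y i = x i} =
      ((Finset.Icc (-(N : ℤ)) N : Finset ℤ) : Set ℤ).pi fun i => {x i} := by
    ext y; simp [Set.pi]
  rw [this]
  exact isOpen_set_pi (Finset.finite_toSet _) fun _ _ => isOpen_discrete _

/-- A set which depends on finitely many letters is open and closed. -/
lemma isClopen_of_local {C : Set Config} (N : ℕ)
    (h : ∀ x y : Config, (∀ i ∈ Finset.Icc (-(N : ℤ)) N, y i = x i) → x ∈ C → y ∈ C) :
    IsClopen C := by
  refine ⟨⟨isOpen_iff_forall_mem_open.2 fun x hx => ?_⟩, isOpen_iff_forall_mem_open.2 fun x hx => ?_⟩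
  · exact ⟨_, fun y hy hyC => hx (h y x (fun i hi => (hy i hi).symm) hyC), isOpen_agree x N,
      fun _ _ => rfl⟩
  · exact ⟨_, fun y hy => h x y hy hx, isOpen_agree x N, fun _ _ => rfl⟩

lemma continuous_mapD : Continuous mapD :=
  continuous_pi fun _ => continuous_localD_comp (continuous_apply _) (continuous_apply _)
    (continuous_apply _)

lemma continuous_mapP : Continuous mapP := by
  refine continuous_pi fun i => continuous_def.2 fun _ _ => ?_
  refine (isClopen_of_local (i.natAbs + 3) fun x y hxy hx => ?_).isOpen
  have : mapP y i = mapP x i :=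
    mapP_congr fun j _ _ => hxy j (Finset.mem_Icc.2 ⟨by omega, by omega⟩)
  rwa [Set.mem_preimage, this]

lemma continuous_F : Continuous F := continuous_mapD.comp continuous_mapP

lemma measurable_F : Measurable F := continuous_F.measurable

/-! ### Rotating one counter -/

lemma injOn_add_mod (a N : ℕ) : Set.InjOn (fun b => (b + a) % N) (Finset.range N) := by
  intro b hb c hc h
  simp only [Finset.coe_range, Set.mem_Iio] at hb hc
  have h1 : b ≡ c [MOD N] := Nat.ModEq.add_right_cancel' a h
  rwa [Nat.ModEq, Nat.mod_eq_of_lt hb, Nat.mod_eq_of_lt hc] at h1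

lemma sum_range_add_mod {M : Type*} [AddCommMonoid M] (a N : ℕ) (g : ℕ → M) :
    ∑ b ∈ Finset.range N, g ((b + a) % N) = ∑ b ∈ Finset.range N, g b := by
  have himg : (Finset.range N).image (fun b => (b + a) % N) = Finset.range N := by
    refine Finset.eq_of_subset_of_card_le (fun c hc => ?_) ?_
    · obtain ⟨b, hb, rfl⟩ := Finset.mem_image.1 hc
      exact Finset.mem_range.2 (Nat.mod_lt _ (by have := Finset.mem_range.1 hb; omega))
    · rw [Finset.card_image_of_injOn (injOn_add_mod a N)]
  conv_rhs => rw [← himg]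
  rw [Finset.sum_image (injOn_add_mod a N)]

lemma uniformState_map (L a : ℕ) :
    (uniformState L).map (fun c => (c + a) % 2 ^ L) = uniformState L := by
  refine Measure.ext_of_singleton fun c => ?_
  rw [Measure.map_apply (measurable_of_countable _) (measurableSet_singleton c),
    uniformState_eq_sum]
  simp only [Measure.smul_apply, Measure.finsetSum_apply, smul_eq_mul,
    Measure.dirac_apply' _ (MeasurableSet.of_discrete)]
  congr 1
  exact sum_range_add_mod a (2 ^ L) (fun b => Set.indicator {c} (1 : ℕ → ℝ≥0∞) b)

/-- Add `a` to the state of the `i`-th counter, modulo `2 ^ K`. -/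
def rotate (i : ℤ) (K a : ℕ) (z : Counters) : Counters := fun j =>
  if j = i then ((z j).1, ((z j).2.1 + a) % 2 ^ K, (z j).2.2) else z j

lemma measurePreserving_rotate {l : ℤ → ℕ} {i : ℤ} {K : ℕ} (hK : l i = K) (a : ℕ) :
    MeasurePreserving (rotate i K a) (muH l) (muH l) := by
  let f : ℤ → ℕ × ℕ × ℕ → ℕ × ℕ × ℕ := fun j b =>
    if j = i then (b.1, (b.2.1 + a) % 2 ^ K, b.2.2) else b
  have hf : ∀ j, Measurable (f j) := fun j => measurable_of_countable _
  have hfm : ∀ j, (counterLaw (l j)).map (f j) = counterLaw (l j) := by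
    intro j
    by_cases hj : j = i
    · subst hj
      subst hK
      have h1 : f j = Prod.map id (Prod.map (fun c => (c + a) % 2 ^ l j) id) := by
        funext b; simp [f, Prod.map]
      rw [h1, counterLaw, ← Measure.map_prod_map _ _ measurable_id (measurable_of_countable _),
        ← Measure.map_prod_map _ _ (measurable_of_countable _) measurable_id, uniformState_map,
        Measure.map_id, Measure.map_id]
    · have h1 : f j = id := by funext b; simp [f, hj]
      rw [h1, Measure.map_id]
  have h2 := Measure.infinitePi_map_pi (fun j => counterLaw (l j)) hf
  simp only [hfm] at h2
  exact ⟨measurable_pi_lambda _ fun j => (hf j).comp (measurable_pi_apply j), h2⟩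

lemma lengths_rotate (i : ℤ) (K a : ℕ) (z : Counters) :
    lengths (rotate i K a z) = lengths z := by
  funext j
  simp only [lengths, rotate]
  split_ifs <;> rfl

lemma rotate_self (i : ℤ) (K a : ℕ) (z : Counters) :
    (rotate i K a z i).2.1 = ((z i).2.1 + a) % 2 ^ K := by
  simp [rotate]

lemma rotate_mem_valid {i : ℤ} {K : ℕ} {z : Counters} {k : ℕ} (hz : z ∈ Valid k)
    (hK : (z i).1 = K) (a : ℕ) : rotate i K a z ∈ Valid k := by
  subst hK
  refine ⟨fun j => ?_, ?_⟩
  · have h := hz.1 j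
    by_cases hj : j = i
    · subst hj
      simp only [rotate, if_true]
      exact ⟨h.1, Nat.mod_lt _ (by positivity), h.2.2⟩
    · simpa only [rotate, if_neg hj] using h
  · have := congrFun (lengths_rotate i (z i).1 a z) 0
    simp only [lengths] at this
    rw [this]; exact hz.2

/-- The configuration up to the `i`-th emitter does not depend on the state of the `i`-th
counter. -/
lemma decode_rotate {i : ℤ} {K : ℕ} {z : Counters} {k a : ℕ} {p : ℤ}
    (hp : p ≤ site (lengths z) k i) : decode k (rotate i K a z) p = decode k z p := by
  have hS := site_strictMono (lengths z) k
  have h := indexOf_spec hS p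
  simp only [decode, letterAt, lengths_rotate]
  split_ifs with h1
  · rfl
  · have h2 : indexOf (site (lengths z) k) p ≠ i := fun h3 => h1 (by rw [h3] at h ⊢; omega)
    simp only [rotate, if_neg h2]

/-- Among the `2 ^ K` rotations of the `i`-th counter, at most `M + 2 K` bring it within `M` of its
maximum at time `t`. -/
lemma card_rotate_le {i : ℤ} {K : ℕ} {z : Counters} {k : ℕ} (hz : z ∈ Valid k)
    (hK : (z i).1 = K) (M t : ℕ) :
    ((Finset.range (2 ^ K)).filter fun a => 2 ^ K <
      block (site (lengths z) k i) K (F^[t] (decode k (rotate i K a z))) + M).card ≤ M + 2 * K := by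
  set s := site (lengths z) k i with hs
  set N := flux (decode k z) s (t - K) with hN
  have key : ∀ a, block s K (F^[t] (decode k (rotate i K a z))) ≤
      (a + ((z i).2.1 + N)) % 2 ^ K + 2 * K := by
    intro a
    have hv := rotate_mem_valid hz hK a
    have hsp : decode k (rotate i K a z) ∈ Spaced := decode_spaced fun j => (hv.1 j).1
    have hsz : decode k z ∈ Spaced := decode_spaced fun j => (hz.1 j).1
    have hl : (rotate i K a z i).1 = K := by
      have := congrFun (lengths_rotate i K a z) i
      simp only [lengths] at this
      rw [this, hK]
    have hb : block s K (decode k (rotate i K a z)) = ((z i).2.1 + a) % 2 ^ K := by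
      have := block_decode (k := k) (hv.1 i).2.1
      rwa [lengths_rotate, hl, rotate_self] at this
    have hd : ∀ j : ℕ, j < K → decode k (rotate i K a z) (s + 1 + j) ≠ emitter := by
      intro j hj
      have := decode_digit (k := k) (z := rotate i K a z) (i := i) (j := j) (by rw [hl]; exact hj)
      rw [lengths_rotate] at this
      rw [hs, this]
      simp [Letter.ofNat]
    have hfl : flux (decode k (rotate i K a z)) s (t - K) = N := by
      refine Finset.sum_congr rfl fun τ _ => ?_
      have h := iterate_F_congr_left hsz hsp (p := s) (fun p hp => decode_rotate hp) τ
      rw [carry, carry, h s le_rfl, h (s - 1) (by omega)]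
    have h := block_iterate_le_mod hsp hd (by rw [hb]; exact Nat.mod_lt _ (by positivity)) t
    rw [hb, hfl, Nat.mod_add_mod] at h
    rwa [show a + ((z i).2.1 + N) = (z i).2.1 + a + N by ring]
  refine (Finset.card_le_card_of_injOn (fun a => (a + ((z i).2.1 + N)) % 2 ^ K)
    (t := Finset.Ico (2 ^ K - (M + 2 * K)) (2 ^ K)) ?_ ?_).trans ?_
  · intro a ha
    simp only [Finset.coe_filter, Set.mem_ofPred_eq] at ha
    have h1 := key a
    have h2 : (a + ((z i).2.1 + N)) % 2 ^ K < 2 ^ K := Nat.mod_lt _ (by positivity)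
    simp only [Finset.coe_Ico, Set.mem_Ico]
    omega
  · exact (injOn_add_mod _ _).mono fun a ha => (Finset.mem_filter.1 ha).1
  · rw [Nat.card_Ico]; omega

/-- At any time, a given counter of length `K` is within `M` of its maximum with probability at most
`(M + 2 K) / 2 ^ K`: averaging over the rotations reduces this to `card_rotate_le`. -/
lemma muH_block_le {l : ℤ → ℕ} (hl : ∀ i, 3 ≤ l i) {k : ℕ} (hk : k ≤ l 0) {i : ℤ} {K : ℕ}
    (hK : l i = K) (M t : ℕ) :
    muH l {z | 2 ^ K < block (site l k i) K (F^[t] (decode k z)) + M} ≤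
      ((M + 2 * K : ℕ) : ℝ≥0∞) / 2 ^ K := by
  set B : Set Counters := {z | 2 ^ K < block (site l k i) K (F^[t] (decode k z)) + M} with hB
  have hBm : MeasurableSet B := by
    have h1 : Measurable fun z => F^[t] (decode k z) := (measurable_F.iterate t).comp (measurable_decode k)
    have h2 : Measurable fun x : Config => block (site l k i) K x := by
      unfold block
      refine Finset.measurable_sum _ fun j _ => Measurable.mul ?_ measurable_const
      exact (measurable_of_countable Letter.val).comp (measurable_pi_apply _)
    exact measurableSet_lt measurable_const ((h2.comp h1).add measurable_const)
  have h1 : ∀ a, muH l B = ∫⁻ z, B.indicator 1 (rotate i K a z) ∂muH l := by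
    intro a
    have hr := measurePreserving_rotate hK a
    rw [← hr.measure_preimage hBm.nullMeasurableSet, ← lintegral_indicator_one (hr.measurable hBm)]
    rfl
  have h2 : (2 ^ K : ℝ≥0∞) * muH l B ≤ (M + 2 * K : ℕ) := by
    calc (2 ^ K : ℝ≥0∞) * muH l B = ∑ a ∈ Finset.range (2 ^ K), muH l B := by simp
      _ = ∑ a ∈ Finset.range (2 ^ K), ∫⁻ z, B.indicator 1 (rotate i K a z) ∂muH l :=
          Finset.sum_congr rfl fun a _ => h1 a
      _ = ∫⁻ z, ∑ a ∈ Finset.range (2 ^ K), B.indicator 1 (rotate i K a z) ∂muH l := by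
          refine (lintegral_finsetSum _ fun a _ => ?_).symm
          exact (measurable_one.indicator hBm).comp (measurePreserving_rotate hK a).measurable
      _ ≤ ∫⁻ z, ((M + 2 * K : ℕ) : ℝ≥0∞) ∂muH l := by
          refine lintegral_mono_ae ?_
          filter_upwards [ae_valid hl hk] with z hz
          have h3 := card_rotate_le hz.1 (i := i) (K := K) (by rw [← hK, ← hz.2]; rfl) M t
          rw [hz.2] at h3
          refine le_trans (le_of_eq ?_) (Nat.cast_le.2 h3)
          rw [Finset.card_filter]
          push_cast
          refine Finset.sum_congr rfl fun a _ => ?_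
          simp only [Set.indicator_apply, hB, Set.mem_ofPred_eq, Pi.one_apply]
      _ = (M + 2 * K : ℕ) := by simp
  rw [ENNReal.le_div_iff_mul_le (by simp) (by simp), mul_comm]
  exact h2

/-! ### The mixture is a probability measure -/

lemma meanLength_eq_lintegral : meanLength = ∫⁻ l, (l 0 : ℝ≥0∞) ∂lengthsLaw := by
  rw [(measurePreserving_eval_lengthsLaw 0).lintegral_comp (f := fun L : ℕ => (L : ℝ≥0∞))
    (measurable_of_countable _), lintegral_countable']
  refine tsum_congr fun L => ?_
  rw [PMF.toMeasure_apply_singleton _ _ (measurableSet_singleton L), mul_comm]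

lemma lintegral_length (i : ℤ) : ∫⁻ l, (l i : ℝ≥0∞) ∂lengthsLaw = meanLength := by
  rw [meanLength_eq_lintegral, (measurePreserving_eval_lengthsLaw 0).lintegral_comp
    (f := fun L : ℕ => (L : ℝ≥0∞)) (measurable_of_countable _),
    (measurePreserving_eval_lengthsLaw i).lintegral_comp
    (f := fun L : ℕ => (L : ℝ≥0∞)) (measurable_of_countable _)]

lemma measurable_length (i : ℤ) : Measurable fun l : ℤ → ℕ => (l i : ℝ≥0∞) :=
  (measurable_of_countable fun L : ℕ => (L : ℝ≥0∞)).comp (measurable_pi_apply i)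

lemma lintegral_length_add (e : ℕ) :
    ∫⁻ l, ((l 0 : ℝ≥0∞) + e) ∂lengthsLaw = meanLength + e := by
  rw [lintegral_add_right _ measurable_const, lintegral_length]
  simp

lemma meanLength_ne_zero : meanLength ≠ 0 := by
  rw [meanLength_eq_lintegral]
  intro h
  rw [lintegral_eq_zero_iff (measurable_length 0)] at h
  have : ∀ᵐ _ ∂lengthsLaw, False := by
    filter_upwards [h, ae_three_le] with l h1 h2
    have h3 := h2 0
    have h4 : l 0 = 0 := by simpa using h1
    omega
  obtain ⟨_, h⟩ := this.exists
  exact h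

lemma lengthLaw_le (L : ℕ) : lengthLaw L ≤ (2 / 3) ^ L * (∑' k : ℕ,
    if 3 ≤ k then (2 / 3 : ℝ≥0∞) ^ k else 0)⁻¹ := by
  rw [lengthLaw, PMF.normalize_apply]
  gcongr
  split_ifs <;> simp

lemma meanLength_ne_top : meanLength ≠ ⊤ := by
  set c : ℝ≥0∞ := (∑' k : ℕ, if 3 ≤ k then (2 / 3 : ℝ≥0∞) ^ k else 0)⁻¹ with hc
  have hc' : c ≠ ⊤ := by
    refine ENNReal.inv_ne_top.2 fun h => ?_
    have h3 := ENNReal.tsum_eq_zero.1 h 3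
    simp at h3
  have h23 : (2 / 3 : ℝ≥0∞) = ENNReal.ofReal (2 / 3) := by
    rw [ENNReal.ofReal_div_of_pos (by norm_num)]; simp
  have hs : Summable fun k : ℕ => (k : ℝ) * (2 / 3 : ℝ) ^ k := by
    have := summable_pow_mul_geometric_of_norm_lt_one (R := ℝ) 1 (r := 2 / 3) (by norm_num)
    simpa using this
  have hle : meanLength ≤ ∑' k : ℕ, ENNReal.ofReal ((k : ℝ) * (2 / 3 : ℝ) ^ k) * c := by
    refine ENNReal.tsum_le_tsum fun k => ?_
    rw [ENNReal.ofReal_mul (by positivity), ENNReal.ofReal_natCast,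
      ENNReal.ofReal_pow (by norm_num), ← h23, mul_comm (lengthLaw k), mul_assoc]
    gcongr
    exact lengthLaw_le k
  refine ne_top_of_le_ne_top ?_ hle
  rw [ENNReal.tsum_mul_right, ← ENNReal.ofReal_tsum_of_nonneg (fun k => by positivity) hs]
  exact ENNReal.mul_ne_top ENNReal.ofReal_ne_top hc'

lemma isProbabilityMeasure_muTilde {e : ℕ} (he : e ≤ 1) : IsProbabilityMeasure (muTilde e) := by
  constructor
  rw [muTilde_apply he MeasurableSet.univ]
  simp only [Set.preimage_univ, measure_univ, Finset.sum_const, Finset.card_range, nsmul_eq_mul,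
    mul_one, Nat.cast_add]
  rw [lintegral_length_add]
  refine ENNReal.inv_mul_cancel (fun h => meanLength_ne_zero ?_) ?_
  · exact (add_eq_zero.1 h).1
  · exact ENNReal.add_ne_top.2 ⟨meanLength_ne_top, ENNReal.natCast_ne_top e⟩

lemma isProbabilityMeasure_cesaro {e : ℕ} (he : e ≤ 1) {n : ℕ} (hn : n ≠ 0) :
    IsProbabilityMeasure (cesaro e n) := by
  have := isProbabilityMeasure_muTilde he
  constructor
  have h : ∀ k, (muTilde e).map F^[k] Set.univ = 1 := fun k => by
    rw [Measure.map_apply (measurable_F.iterate k) MeasurableSet.univ]; simp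
  simp only [cesaro, Measure.smul_apply, Measure.finsetSum_apply, h, Finset.sum_const,
    Finset.card_range, smul_eq_mul, nsmul_eq_mul, mul_one]
  exact ENNReal.inv_mul_cancel (by simpa using hn) (ENNReal.natCast_ne_top n)

/-- The measures `μ^F` exist because the probability measures on the compact metrizable space
`A^ℤ` form a compact metrizable space. -/
lemma exists_isMuF {e : ℕ} (he : e ≤ 1) : ∃ μ : Measure Config, IsMuF e μ := by
  let u : ℕ → ProbabilityMeasure Config := fun n =>
    ⟨cesaro e (n + 1), isProbabilityMeasure_cesaro he n.succ_ne_zero⟩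
  obtain ⟨μ, ψ, hψ, hlim⟩ := CompactSpace.tendsto_subseq u
  refine ⟨μ, inferInstance, fun j => ψ j + 1, fun i j hij => Nat.succ_lt_succ (hψ hij), fun f => ?_⟩
  exact ProbabilityMeasure.tendsto_iff_forall_integral_tendsto.1 hlim
    (BoundedContinuousFunction.mkOfCompact f)

/-! ### Weak limits -/

lemma cesaro_le {e : ℕ} {C : Set Config} (hC : MeasurableSet C) {ε : ℝ≥0∞}
    (h : ∀ k, muTilde e (F^[k] ⁻¹' C) ≤ ε) (n : ℕ) : cesaro e n C ≤ ε := by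
  simp only [cesaro, Measure.smul_apply, Measure.finsetSum_apply, smul_eq_mul,
    Measure.map_apply (measurable_F.iterate _) hC]
  calc (n : ℝ≥0∞)⁻¹ * ∑ k ∈ Finset.range n, muTilde e (F^[k] ⁻¹' C)
      ≤ (n : ℝ≥0∞)⁻¹ * ∑ k ∈ Finset.range n, ε := by
        gcongr with k _; exact h k
    _ = (n : ℝ≥0∞)⁻¹ * n * ε := by simp [mul_assoc]
    _ ≤ 1 * ε := by gcongr; exact ENNReal.inv_mul_le_one _
    _ = ε := one_mul _

/-- A bound for a clopen event at all times passes to the weak limits. -/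
lemma IsMuF.le {e : ℕ} {μ : Measure Config} (hμ : IsMuF e μ) {C : Set Config}
    (hC : IsClopen C) {ε : ℝ≥0∞} (h : ∀ k, muTilde e (F^[k] ⁻¹' C) ≤ ε) : μ C ≤ ε := by
  obtain ⟨hprob, m, hm, hlim⟩ := hμ
  rcases eq_or_ne ε ⊤ with rfl | hε
  · exact le_top
  have hCm : MeasurableSet C := hC.isOpen.measurableSet
  let f : C(Config, ℝ) := ⟨C.indicator 1, (LocallyConstant.charFn ℝ hC).continuous⟩
  have hf : ∀ ρ : Measure Config, ∫ x, f x ∂ρ = ρ.real C := fun ρ => integral_indicator_one hCm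
  have h1 := hlim f
  simp only [hf] at h1
  have h2 : μ.real C ≤ ε.toReal := by
    refine le_of_tendsto' h1 fun j => ?_
    exact ENNReal.toReal_mono hε (cesaro_le hCm h _)
  rw [← ENNReal.ofReal_toReal hε, ← ENNReal.ofReal_toReal (measure_ne_top μ C)]
  exact ENNReal.ofReal_le_ofReal h2

lemma muTilde_eq_zero {e : ℕ} (he : e ≤ 1) {B : Set Config} (hB : MeasurableSet B)
    (h : ∀ x ∈ B, x ∉ Omega) : muTilde e B = 0 := by
  rw [muTilde_apply he hB]
  refine mul_eq_zero_of_right _ ?_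
  rw [lintegral_eq_zero_iff']
  · filter_upwards [ae_three_le] with l hl
    refine Finset.sum_eq_zero fun k hk => ?_
    have hk' : k ≤ l 0 := by have := Finset.mem_range.1 hk; omega
    rw [measure_eq_zero_iff_ae_notMem]
    filter_upwards [ae_valid hl hk'] with z hz hzB
    exact h _ hzB (decode_mem_omegaStar hz.1).1
  · simp only [← tower_apply e _ hB]
    exact ((Measure.measurable_coe hB).comp (measurable_tower e)).aemeasurable

/-- The points without emitter in a given finite set of sites. -/
def noEmitter (I : Finset ℤ) : Set Config := {x | ∀ i ∈ I, x i ≠ emitter}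

lemma exists_bound (I : Finset ℤ) : ∃ N : ℕ, ∀ i ∈ I, i ∈ Finset.Icc (-(N : ℤ)) N := by
  refine ⟨I.sup Int.natAbs, fun i hi => ?_⟩
  have := Finset.le_sup (f := Int.natAbs) hi
  rw [Finset.mem_Icc]
  omega

lemma isClopen_noEmitter (I : Finset ℤ) : IsClopen (noEmitter I) := by
  obtain ⟨N, hN⟩ := exists_bound I
  exact isClopen_of_local N fun x y hxy hx i hi => by rw [hxy i (hN i hi)]; exact hx i hi

lemma iterate_F_mem_noEmitter {x : Config} (hx : x ∈ Omega) {I : Finset ℤ} {k : ℕ} :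
    F^[k] x ∈ noEmitter I ↔ x ∈ noEmitter I :=
  forall₂_congr fun i _ => not_congr (iterate_F_eq_emitter (Omega_subset_Spaced hx) k i)

section Limit

variable {e : ℕ} (he : e ≤ 1) {μ : Measure Config} (hμ : IsMuF e μ)
include he hμ

/-- Since `F` does not move the emitters of a point of `Ω`, the limit measures have no more gaps
than `μ̃^F`. -/
lemma IsMuF.noEmitter_le (I : Finset ℤ) : μ (noEmitter I) ≤ muTilde e (noEmitter I) := by
  refine hμ.le (isClopen_noEmitter I) fun k => ?_
  have hm := (isClopen_noEmitter I).isOpen.measurableSet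
  have hm' := (measurable_F.iterate k) hm
  refine (measure_mono (Set.subset_union_left (t := noEmitter I))).trans ?_
  rw [← Set.sdiff_union_self]
  refine (measure_union_le _ _).trans ?_
  rw [muTilde_eq_zero he (hm'.diff hm) fun x hx hxO => hx.2 ((iterate_F_mem_noEmitter hxO).1 hx.1),
    zero_add]

lemma IsMuF.iInter_noEmitter (I : ℕ → Finset ℤ) (hI : Monotone I)
    (h : ∀ x ∈ Omega, ∃ m, ∃ i ∈ I m, x i = emitter) : μ (⋂ m, noEmitter (I m)) = 0 := by
  have := isProbabilityMeasure_muTilde he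
  have hm : ∀ m, NullMeasurableSet (noEmitter (I m)) (muTilde e) := fun m =>
    (isClopen_noEmitter (I m)).isOpen.measurableSet.nullMeasurableSet
  have hanti : Antitone fun m => noEmitter (I m) := fun a b hab x hx i hi => hx i (hI hab hi)
  have hlim := tendsto_measure_iInter_atTop hm hanti ⟨0, measure_ne_top _ _⟩
  rw [muTilde_eq_zero he (MeasurableSet.iInter fun m =>
    (isClopen_noEmitter (I m)).isOpen.measurableSet) fun x hx hxO => ?_] at hlim
  · refine le_antisymm (ge_of_tendsto' hlim fun m => ?_) (zero_le)
    exact (measure_mono (Set.iInter_subset _ m)).trans (hμ.noEmitter_le he (I m))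
  · obtain ⟨m, i, hi, hxi⟩ := h x hxO
    exact Set.mem_iInter.1 hx m i hi hxi

lemma IsMuF.ae_omega : ∀ᵐ x ∂μ, x ∈ Omega := by
  have hright : ∀ N : ℤ, ∀ᵐ x ∂μ, ∃ i ≥ N, x i = emitter := fun N => by
    have h := hμ.iInter_noEmitter he (fun m => Finset.Icc N (N + m))
      (fun a b hab => Finset.Icc_subset_Icc_right (by simpa using hab)) fun x hx => by
        obtain ⟨i, hi, hxi⟩ := hx.1 N
        exact ⟨(i - N).toNat, i, Finset.mem_Icc.2 ⟨hi, by omega⟩, hxi⟩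
    filter_upwards [measure_eq_zero_iff_ae_notMem.1 h] with x hx
    simp only [Set.mem_iInter, noEmitter, Set.mem_ofPred_eq, not_forall, not_not] at hx
    obtain ⟨m, i, hi, hxi⟩ := hx
    exact ⟨i, (Finset.mem_Icc.1 hi).1, hxi⟩
  have hleft : ∀ N : ℤ, ∀ᵐ x ∂μ, ∃ i ≤ N, x i = emitter := fun N => by
    have h := hμ.iInter_noEmitter he (fun m => Finset.Icc (N - m) N)
      (fun a b hab => Finset.Icc_subset_Icc_left (by omega)) fun x hx => by
        obtain ⟨i, hi, hxi⟩ := hx.2.1 N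
        exact ⟨(N - i).toNat, i, Finset.mem_Icc.2 ⟨by omega, hi⟩, hxi⟩
    filter_upwards [measure_eq_zero_iff_ae_notMem.1 h] with x hx
    simp only [Set.mem_iInter, noEmitter, Set.mem_ofPred_eq, not_forall, not_not] at hx
    obtain ⟨m, i, hi, hxi⟩ := hx
    exact ⟨i, (Finset.mem_Icc.1 hi).2, hxi⟩
  have hgap : ∀ i j : ℤ, ∀ᵐ x ∂μ, x i = emitter → x j = emitter → i < j → i + 4 ≤ j := fun i j => by
    by_cases hij : i < j ∧ j < i + 4
    · have hC : IsClopen {x : Config | x i = emitter ∧ x j = emitter} := by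
        obtain ⟨N, hN⟩ := exists_bound {i, j}
        refine isClopen_of_local N fun x y hxy hx => ?_
        rw [Set.mem_ofPred_eq, hxy i (hN i (by simp)), hxy j (hN j (by simp))]
        exact hx
      have h0 : μ {x : Config | x i = emitter ∧ x j = emitter} ≤ 0 := by
        refine hμ.le hC fun k => (muTilde_eq_zero he
          ((measurable_F.iterate k) hC.isOpen.measurableSet) fun x hx hxO => ?_).le
        have hs := Omega_subset_Spaced hxO
        have := iterate_F_spaced hs k i j hx.1 hx.2 hij.1
        omega
      filter_upwards [measure_eq_zero_iff_ae_notMem.1 (le_antisymm h0 zero_le)] with x hx h1 h2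
      exact absurd ⟨h1, h2⟩ hx
    · exact Eventually.of_forall fun x _ _ h => by omega
  filter_upwards [ae_all_iff.2 hright, ae_all_iff.2 hleft,
    ae_all_iff.2 fun i => ae_all_iff.2 (hgap i)] with x h1 h2 h3
  exact ⟨h1, h2, h3⟩

end Limit

/-! ### A clopen event that slows down perturbations -/

/-- The configurations with an emitter at `a ≤ 0` and one at `q > 0`, at most `R` sites apart, and
with a counter of length `K` on their left, between the emitters `s` and `s + K + 1`, which is at
least `M` below its maximum; everything happens within `n` sites. -/
def goodSet (n K M R : ℕ) : Set Config :=
  {x | ∃ a q s : ℤ, (a ≤ 0 ∧ 0 < q ∧ q ≤ n ∧ q ≤ a + R + 1 ∧ -n + 3 ≤ s ∧ s + K + 1 ≤ a ∧ q ≤ s + n) ∧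
    (x a = emitter ∧ x q = emitter ∧ x s = emitter ∧ x (s + K + 1) = emitter) ∧
    (∀ j : ℕ, j < K → x (s + 1 + j) ≠ emitter) ∧ block s K x + M ≤ 2 ^ K}

lemma isClopen_goodSet (n K M R : ℕ) : IsClopen (goodSet n K M R) := by
  refine isClopen_of_local n fun x y hxy hx => ?_
  obtain ⟨a, q, s, h1, h2, h3, h4⟩ := hx
  have hb : block s K y = block s K x := Finset.sum_congr rfl fun j hj => by
    have := Finset.mem_range.1 hj
    rw [hxy _ (Finset.mem_Icc.2 ⟨by omega, by omega⟩)]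
  refine ⟨a, q, s, h1, ?_, fun j hj => ?_, by rwa [hb]⟩
  · rwa [hxy a (Finset.mem_Icc.2 ⟨by omega, by omega⟩),
      hxy q (Finset.mem_Icc.2 ⟨by omega, by omega⟩),
      hxy s (Finset.mem_Icc.2 ⟨by omega, by omega⟩),
      hxy (s + K + 1) (Finset.mem_Icc.2 ⟨by omega, by omega⟩)]
  · rw [hxy _ (Finset.mem_Icc.2 ⟨by omega, by omega⟩)]
    exact h3 j hj

/-- The sequences of lengths for which the origin is in a long counter, or no counter among the
next `m` ones to the left has length `K`, or these counters take more than `H` sites. -/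
def badLengths (K R m H : ℕ) : Set (ℤ → ℕ) :=
  {l | R < l 0} ∪ {l | ∀ j ∈ Finset.range m, l (-((j : ℤ) + 1)) ≠ K} ∪
    {l | H < ∑ j ∈ Finset.range m, (l (-((j : ℤ) + 1)) + 1)}

lemma measurableSet_badLengths (K R m H : ℕ) : MeasurableSet (badLengths K R m H) := by
  have h : ∀ i : ℤ, Measurable fun l : ℤ → ℕ => l i := fun i => measurable_pi_apply i
  refine (MeasurableSet.union ?_ ?_).union ?_
  · exact measurableSet_lt measurable_const (h 0)
  · have : {l : ℤ → ℕ | ∀ j ∈ Finset.range m, l (-((j : ℤ) + 1)) ≠ K} =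
        ⋂ j ∈ Finset.range m, (fun l : ℤ → ℕ => l (-((j : ℤ) + 1))) ⁻¹' {K}ᶜ := by
      ext l; simp
    rw [this]
    exact Finset.measurableSet_biInter _ fun j _ => h _ MeasurableSet.of_discrete
  · exact measurableSet_lt measurable_const (Finset.measurable_sum _ fun j _ =>
      (h _).add measurable_const)

lemma mem_goodSet {n K M R m H : ℕ} (hn : H + 2 * R + 4 ≤ n) {k t : ℕ} {z : Counters}
    (hz : z ∈ Valid k) (h0 : lengths z 0 ≤ R)
    (hH : ∑ j ∈ Finset.range m, (lengths z (-((j : ℤ) + 1)) + 1) ≤ H) {j : ℕ} (hj : j < m)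
    (hK : lengths z (-((j : ℤ) + 1)) = K)
    (hb : block (site (lengths z) k (-((j : ℤ) + 1))) K (F^[t] (decode k z)) + M ≤ 2 ^ K) :
    F^[t] (decode k z) ∈ goodSet n K M R := by
  have hsp : decode k z ∈ Spaced := decode_spaced fun i => (hz.1 i).1
  have hE := iterate_F_eq_emitter hsp t
  have hS := site_strictMono (lengths z) k
  have hkl : k ≤ lengths z 0 := hz.2
  have h1 := site_add_one (lengths z) k 0
  have h2 := site_add_one (lengths z) k (-((j : ℤ) + 1))
  rw [site_zero, zero_add] at h1
  rw [hK] at h2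
  have h3 := hS.monotone (show -((j : ℤ) + 1) + 1 ≤ 0 by omega)
  have h4 := hS.monotone (show -(m : ℤ) ≤ -((j : ℤ) + 1) by omega)
  rw [site_zero] at h3
  have h5 : site (lengths z) k (-m) =
      -k - (∑ j ∈ Finset.range m, (lengths z (-((j : ℤ) + 1)) + 1) : ℕ) := by
    have h6 : (-(m : ℤ)).toNat = 0 := by omega
    simp [site, h6]
  refine ⟨-k, site (lengths z) k 1, site (lengths z) k (-((j : ℤ) + 1)),
    ⟨by omega, by omega, by omega, by omega, by omega, by omega, by omega⟩,
    ⟨?_, ?_, ?_, ?_⟩, fun i hi => ?_, hb⟩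
  · rw [hE, decode_eq_emitter]; exact ⟨0, site_zero _ _⟩
  · rw [hE, decode_eq_emitter]; exact ⟨1, rfl⟩
  · rw [hE, decode_eq_emitter]; exact ⟨_, rfl⟩
  · rw [hE, decode_eq_emitter]; exact ⟨_, h2⟩
  · rw [Ne, hE, decode_digit (by rw [← hK] at hi; exact hi)]
    simp [Letter.ofNat]

lemma muTilde_goodSet_compl_le {e : ℕ} (he : e ≤ 1) {n K M R m H : ℕ} (hn : H + 2 * R + 4 ≤ n)
    (t : ℕ) :
    muTilde e (F^[t] ⁻¹' (goodSet n K M R)ᶜ) ≤ ((M + 2 * K : ℕ) : ℝ≥0∞) / 2 ^ K +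
      (meanLength + e)⁻¹ * ∫⁻ l in badLengths K R m H, ((l 0 : ℝ≥0∞) + e) ∂lengthsLaw := by
  have hGm : MeasurableSet (F^[t] ⁻¹' (goodSet n K M R)ᶜ) :=
    (measurable_F.iterate t) (isClopen_goodSet n K M R).isOpen.measurableSet.compl
  have hAm := measurableSet_badLengths K R m H
  set ε : ℝ≥0∞ := ((M + 2 * K : ℕ) : ℝ≥0∞) / 2 ^ K with hε
  set A := badLengths K R m H with hA
  have hint : ∀ᵐ l ∂lengthsLaw,
      ∑ k ∈ Finset.range (l 0 + e), muH l (decode k ⁻¹' (F^[t] ⁻¹' (goodSet n K M R)ᶜ)) ≤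
        ε * ((l 0 : ℝ≥0∞) + e) + A.indicator (fun l => (l 0 : ℝ≥0∞) + e) l := by
    filter_upwards [ae_three_le] with l hl
    by_cases hlA : l ∈ A
    · rw [Set.indicator_of_mem hlA]
      refine le_add_left ?_
      calc _ ≤ ∑ k ∈ Finset.range (l 0 + e), (1 : ℝ≥0∞) := Finset.sum_le_sum fun k _ => prob_le_one
        _ = _ := by simp
    · rw [Set.indicator_of_notMem hlA, add_zero]
      simp only [hA, badLengths, Set.mem_union, Set.mem_ofPred_eq, not_or, not_lt, not_forall,
        not_not, exists_prop, Finset.mem_range] at hlA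
      obtain ⟨⟨h0, j, hj, hK⟩, hH⟩ := hlA
      calc _ ≤ ∑ k ∈ Finset.range (l 0 + e), ε := Finset.sum_le_sum fun k hk => ?_
        _ = _ := by simp [mul_comm]
      have hk' : k ≤ l 0 := by have := Finset.mem_range.1 hk; omega
      refine le_trans (measure_mono_ae ?_) (muH_block_le hl hk' hK M t)
      filter_upwards [ae_valid hl hk'] with z hz hzG
      by_contra hb
      apply hzG
      have hb' : block (site l k (-((j : ℤ) + 1))) K (F^[t] (decode k z)) + M ≤ 2 ^ K :=
        not_lt.1 hb
      rw [← hz.2] at h0 hH hK hb'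
      exact mem_goodSet hn hz.1 h0 hH hj hK hb'
  rw [muTilde_apply he hGm]
  have hm : Measurable fun l : ℤ → ℕ => (l 0 : ℝ≥0∞) + e :=
    (measurable_length 0).add measurable_const
  calc _ ≤ (meanLength + e)⁻¹ * ∫⁻ l, (ε * ((l 0 : ℝ≥0∞) + e) +
          A.indicator (fun l => (l 0 : ℝ≥0∞) + e) l) ∂lengthsLaw := by
        gcongr 1
        exact lintegral_mono_ae hint
    _ = ε * ((meanLength + e)⁻¹ * (meanLength + e)) +
          (meanLength + e)⁻¹ * ∫⁻ l in A, ((l 0 : ℝ≥0∞) + e) ∂lengthsLaw := by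
        rw [lintegral_add_left (hm.const_mul ε), lintegral_const_mul _ hm, lintegral_length_add,
          lintegral_indicator hAm, mul_add]
        ring
    _ ≤ _ := by
        gcongr
        exact mul_le_of_le_one_right' (ENNReal.inv_mul_le_one _)

/-- In a good configuration of `Ω`, the large counter has not overflowed and needs at least `M`
steps to do so. -/
lemma le_crossTime_of_mem_goodSet {n K M R : ℕ} (hK : 0 < K) {x : Config} (hx : x ∈ Omega)
    (hg : x ∈ goodSet n K (2 * M) R) : (M : ℕ∞) ≤ crossTime F n x := by
  obtain ⟨a, q, s, h1, h2, h3, h4⟩ := hg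
  exact le_crossTime (Omega_subset_Spaced hx) hK h2.2.2.2 h3 (by omega) (by omega) h4

lemma sum_len_le {x : Config} (hx : x ∈ Omega) (m : ℕ) :
    ((∑ j ∈ Finset.Icc (-(m : ℤ)) 0, len x j : ℕ) : ℤ) ≤ pos x 1 - pos x (-m) := by
  induction m with
  | zero =>
    have := pos_add_one hx 0
    rw [zero_add] at this
    simp only [Nat.cast_zero, neg_zero, Finset.Icc_self, Finset.sum_singleton]
    omega
  | succ m ih =>
    have h1 : Finset.Icc (-((m + 1 : ℕ) : ℤ)) 0 =
        insert (-((m + 1 : ℕ) : ℤ)) (Finset.Icc (-(m : ℤ)) 0) := by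
      ext i; simp only [Finset.mem_Icc, Finset.mem_insert]; omega
    have h2 := pos_add_one hx (-((m + 1 : ℕ) : ℤ))
    rw [h1, Finset.sum_insert (by simp only [Finset.mem_Icc]; omega)]
    rw [show -((m + 1 : ℕ) : ℤ) + 1 = -(m : ℤ) by push_cast; ring] at h2
    push_cast at *
    omega

lemma mem_slowSet_of_mem_goodSet {n K M R : ℕ} {x : Config} (hx : x ∈ Omega)
    (hg : x ∈ goodSet n K M R) (hR : (R : ℝ) ≤ 2 * Real.log n) (hK : 2 * Real.log n ≤ K)
    (hM : (2 : ℝ) ^ (1.5 * Real.log n) ≤ M) : x ∈ slowSet n := by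
  obtain ⟨a, q, s, ⟨ha, hq, -, hqa, hs, hsa, hqs⟩, ⟨hEa, hEq, hEs, hEp⟩, hd, hb⟩ := hg
  have hS := pos_strictMono hx
  obtain ⟨i, rfl⟩ := (eq_emitter_iff_pos hx s).1 hEs
  obtain ⟨α, rfl⟩ := (eq_emitter_iff_pos hx a).1 hEa
  obtain ⟨β, rfl⟩ := (eq_emitter_iff_pos hx q).1 hEq
  obtain ⟨γ, hγ⟩ := (eq_emitter_iff_pos hx _).1 hEp
  have hα : α < 1 := hS.lt_iff_lt.1 (ha.trans_lt (pos_one_pos hx))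
  have hβ : 0 < β := hS.lt_iff_lt.1 ((pos_zero_le hx).trans_lt hq)
  have hiα : i < α := hS.lt_iff_lt.1 (by omega)
  have hα0 := hS.monotone (show α ≤ 0 by omega)
  have hβ1 := hS.monotone (show 1 ≤ β by omega)
  have hγi : γ = i + 1 := by
    have h1 : i < γ := hS.lt_iff_lt.1 (by omega)
    by_contra hne
    have h2 := hS (show i + 1 < γ by omega)
    have h3 := pos_add_one hx i
    refine hd (len x i) (by omega) ?_
    rw [show pos x i + 1 + (len x i : ℤ) = pos x (i + 1) by omega]
    exact apply_pos hx _
  subst hγi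
  have hl := pos_add_one hx i
  have hlen : len x i = K := by omega
  have hl0 := pos_add_one hx 0
  rw [zero_add] at hl0
  refine ⟨hx, ?_, i, by omega, ?_, by rw [hlen]; exact hK, ?_⟩
  · have : len x 0 ≤ R := by omega
    exact le_trans (by exact_mod_cast this) hR
  · obtain ⟨m, rfl⟩ : ∃ m : ℕ, i = -(m : ℤ) := ⟨(-i).toNat, by omega⟩
    have := sum_len_le hx m
    omega
  · have h1 : state x i + M ≤ 2 ^ K := by
      refine le_trans (Nat.add_le_add_right (Nat.mod_le _ _) M) ?_
      rw [total_eq_block hx, hlen]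
      exact hb
    have h2 : (state x i : ℝ) + M ≤ 2 ^ K := by exact_mod_cast h1
    rw [hlen]
    linarith

/-! ### Estimates on the lengths -/

lemma tendsto_natCast_div {a b : ℕ → ℕ} (hb : ∀ᶠ n in atTop, b n ≠ 0)
    (h : Tendsto (fun n => (a n : ℝ) / b n) atTop (𝓝 0)) :
    Tendsto (fun n => (a n : ℝ≥0∞) / b n) atTop (𝓝 0) := by
  have h1 := ENNReal.tendsto_ofReal h
  rw [ENNReal.ofReal_zero] at h1
  refine h1.congr' ?_
  filter_upwards [hb] with n hn
  rw [ENNReal.ofReal_div_of_pos (by positivity), ENNReal.ofReal_natCast, ENNReal.ofReal_natCast]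

lemma le_lengthLaw {K : ℕ} (hK : 3 ≤ K) : (2 / 3 : ℝ) ^ K / 3 ≤ (lengthLaw K).toReal := by
  have h23 : (2 / 3 : ℝ≥0∞) = ENNReal.ofReal (2 / 3) := by
    rw [ENNReal.ofReal_div_of_pos (by norm_num)]; simp
  have h3 : (∑' k : ℕ, if 3 ≤ k then (2 / 3 : ℝ≥0∞) ^ k else 0) ≤ 3 := by
    calc _ ≤ ∑' k : ℕ, (2 / 3 : ℝ≥0∞) ^ k := ENNReal.tsum_le_tsum fun k => by split_ifs <;> simp
      _ = ENNReal.ofReal (∑' k : ℕ, (2 / 3 : ℝ) ^ k) := by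
        rw [ENNReal.ofReal_tsum_of_nonneg (fun k => by positivity)
          (summable_geometric_of_lt_one (by norm_num) (by norm_num))]
        refine tsum_congr fun k => ?_
        rw [ENNReal.ofReal_pow (by norm_num), h23]
      _ = 3 := by
        rw [tsum_geometric_of_lt_one (by norm_num) (by norm_num)]; norm_num
  have h4 : ENNReal.ofReal ((2 / 3 : ℝ) ^ K / 3) ≤ lengthLaw K := by
    rw [lengthLaw, PMF.normalize_apply, if_pos hK, ENNReal.ofReal_div_of_pos (by norm_num),
      ENNReal.ofReal_pow (by norm_num), ← h23, div_eq_mul_inv]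
    gcongr
    simpa using h3
  exact (ENNReal.ofReal_le_iff_le_toReal (PMF.apply_ne_top _ _)).1 h4

lemma lengthsLaw_forall_ne (m K : ℕ) :
    lengthsLaw {l | ∀ j ∈ Finset.range m, l (-((j : ℤ) + 1)) ≠ K} =
      ENNReal.ofReal ((1 - (lengthLaw K).toReal) ^ m) := by
  have hp : lengthLaw K ≤ 1 := PMF.coe_le_one _ _
  have hinj : Function.Injective fun j : ℕ => -((j : ℤ) + 1) := fun i j h => by
    simp only at h; omega
  have h1 : {l : ℤ → ℕ | ∀ j ∈ Finset.range m, l (-((j : ℤ) + 1)) ≠ K} =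
      ((((Finset.range m).image fun j : ℕ => -((j : ℤ) + 1) : Finset ℤ) : Set ℤ)).pi
        fun _ => {K}ᶜ := by
    ext l; simp [Set.pi]
  rw [h1, lengthsLaw, Measure.infinitePi_pi _ fun _ _ => MeasurableSet.of_discrete,
    Finset.prod_const, Finset.card_image_of_injective _ hinj, Finset.card_range,
    prob_compl_eq_one_sub MeasurableSet.of_discrete,
    PMF.toMeasure_apply_singleton _ _ (measurableSet_singleton K),
    ENNReal.ofReal_pow (sub_nonneg.2 (ENNReal.toReal_le_of_le_ofReal zero_le_one (by simpa using hp))),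
    ENNReal.ofReal_sub _ ENNReal.toReal_nonneg, ENNReal.ofReal_one,
    ENNReal.ofReal_toReal (PMF.apply_ne_top _ _)]

lemma lengthsLaw_lt_le (R : ℕ) (hR : R ≠ 0) : lengthsLaw {l | R < l 0} ≤ meanLength / R := by
  rw [← lintegral_length 0]
  refine le_trans (measure_mono fun l hl => ?_) (meas_ge_le_lintegral_div
    (measurable_length 0).aemeasurable (by simpa using hR) (ENNReal.natCast_ne_top R))
  exact Nat.cast_le (α := ℝ≥0∞).2 (le_of_lt hl)

lemma lengthsLaw_sum_lt_le (m H : ℕ) (hH : H ≠ 0) :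
    lengthsLaw {l | H < ∑ j ∈ Finset.range m, (l (-((j : ℤ) + 1)) + 1)} ≤
      (m : ℝ≥0∞) / H * (meanLength + 1) := by
  have hm : ∀ j : ℕ, Measurable fun l : ℤ → ℕ => (l (-((j : ℤ) + 1)) : ℝ≥0∞) + 1 := fun j =>
    (measurable_length _).add measurable_const
  have h1 : ∫⁻ l, ∑ j ∈ Finset.range m, ((l (-((j : ℤ) + 1)) : ℝ≥0∞) + 1) ∂lengthsLaw =
      m * (meanLength + 1) := by
    rw [lintegral_finsetSum _ fun j _ => hm j]
    simp [lintegral_add_right _ measurable_const, lintegral_length, mul_add]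
  rw [show (m : ℝ≥0∞) / H * (meanLength + 1) = m * (meanLength + 1) / H by
    rw [div_eq_mul_inv, div_eq_mul_inv]; ring, ← h1]
  refine le_trans (measure_mono fun l hl => ?_) (meas_ge_le_lintegral_div
    (Finset.measurable_sum _ fun j _ => hm j).aemeasurable (by simpa using hH)
    (ENNReal.natCast_ne_top H))
  have := Nat.cast_le (α := ℝ≥0∞).2 (le_of_lt hl)
  push_cast at this
  exact this

/-! ### The choice of the parameters -/

/-- The length of the large counter. -/
noncomputable def counterLength (n : ℕ) : ℕ := ⌈2 * Real.log n⌉₊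

/-- The bound on the length of the counter at the origin. -/
noncomputable def originLength (n : ℕ) : ℕ := ⌊2 * Real.log n⌋₊

/-- The number of counters among which a large one is sought: more than the inverse of its
frequency, which is of order `n ^ (2 ln (3/2))`, and negligible with respect to `n`. -/
noncomputable def numCounters (n : ℕ) : ℕ := ⌊(n : ℝ) ^ (0.9 : ℝ)⌋₊

/-- The time during which the large counter is required not to overflow. -/
noncomputable def delay (n : ℕ) : ℕ := ⌈(2 : ℝ) ^ (1.5 * Real.log n)⌉₊

lemma tendsto_log_natCast : Tendsto (fun n : ℕ => Real.log n) atTop atTop :=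
  Real.tendsto_log_atTop.comp tendsto_natCast_atTop_atTop

lemma tendsto_counterLength : Tendsto counterLength atTop atTop :=
  tendsto_nat_ceil_atTop.comp (tendsto_log_natCast.const_mul_atTop (by norm_num))

lemma tendsto_originLength : Tendsto originLength atTop atTop :=
  tendsto_nat_floor_atTop.comp (tendsto_log_natCast.const_mul_atTop (by norm_num))

lemma rpow_log_eq {a : ℝ} (ha : 0 < a) {n : ℕ} (hn : 0 < n) (b : ℝ) :
    a ^ (b * Real.log n) = (n : ℝ) ^ (b * Real.log a) := by
  have hn' : (0 : ℝ) < n := by exact_mod_cast hn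
  rw [Real.rpow_def_of_pos ha, Real.rpow_def_of_pos hn']
  ring_nf

lemma eventually_add_le :
    ∀ᶠ n : ℕ in atTop, n / 2 + 2 * originLength n + 4 ≤ n := by
  have h := (Real.isLittleO_log_id_atTop.comp_tendsto tendsto_natCast_atTop_atTop).bound
    (show (0 : ℝ) < 1 / 16 by norm_num)
  filter_upwards [h, eventually_ge_atTop 16] with n hn hn16
  have h1 : (originLength n : ℝ) ≤ 2 * Real.log n :=
    Nat.floor_le (by have := Real.log_natCast_nonneg n; linarith)
  have h2 : Real.log n ≤ 1 / 16 * n := by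
    have := (le_abs_self _).trans hn
    simpa using this
  have h3 : (16 : ℝ) ≤ n := by exact_mod_cast hn16
  have h4 : ((n / 2 : ℕ) : ℝ) ≤ n / 2 := Nat.cast_div_le
  have h5 : ((n / 2 + 2 * originLength n + 4 : ℕ) : ℝ) ≤ n := by push_cast; linarith
  exact_mod_cast h5

lemma tendsto_lt_originLength :
    Tendsto (fun n => lengthsLaw {l | originLength n < l 0}) atTop (𝓝 0) := by
  have h1 : Tendsto (fun n => meanLength / (originLength n : ℝ≥0∞)) atTop (𝓝 0) := by
    have h := ENNReal.Tendsto.const_div (a := meanLength)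
      (ENNReal.tendsto_nat_nhds_top.comp tendsto_originLength) (Or.inr meanLength_ne_top)
    simpa using h
  refine tendsto_of_tendsto_of_tendsto_of_le_of_le' tendsto_const_nhds h1
    (Eventually.of_forall fun _ => zero_le) ?_
  filter_upwards [tendsto_originLength.eventually_ne_atTop 0] with n hn
  exact lengthsLaw_lt_le _ hn

lemma tendsto_sum_lt :
    Tendsto (fun n : ℕ => lengthsLaw
      {l | n / 2 < ∑ j ∈ Finset.range (numCounters n), (l (-((j : ℤ) + 1)) + 1)}) atTop (𝓝 0) := by
  have hr : Tendsto (fun n : ℕ => (numCounters n : ℝ) / ((n / 2 : ℕ) : ℝ)) atTop (𝓝 0) := by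
    have h1 : Tendsto (fun n : ℕ => 4 * (n : ℝ) ^ (-(0.1 : ℝ))) atTop (𝓝 0) := by
      simpa using ((tendsto_rpow_neg_atTop (show (0 : ℝ) < 0.1 by norm_num)).comp
        tendsto_natCast_atTop_atTop).const_mul 4
    refine squeeze_zero' (Eventually.of_forall fun n => by positivity) ?_ h1
    filter_upwards [eventually_ge_atTop 2] with n hn
    have hn' : (0 : ℝ) < n := by exact_mod_cast (by omega : 0 < n)
    have h2 : (numCounters n : ℝ) ≤ (n : ℝ) ^ (0.9 : ℝ) := Nat.floor_le (by positivity)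
    have h3 : (n : ℝ) / 4 ≤ ((n / 2 : ℕ) : ℝ) := by
      have : (n : ℝ) ≤ ((4 * (n / 2) : ℕ) : ℝ) := by exact_mod_cast (by omega : n ≤ 4 * (n / 2))
      push_cast at this
      linarith
    calc (numCounters n : ℝ) / ((n / 2 : ℕ) : ℝ) ≤ (n : ℝ) ^ (0.9 : ℝ) / ((n : ℝ) / 4) := by
          gcongr
      _ = 4 * ((n : ℝ) ^ (0.9 : ℝ) / (n : ℝ) ^ (1 : ℝ)) := by rw [Real.rpow_one]; field_simp
      _ = 4 * (n : ℝ) ^ (-(0.1 : ℝ)) := by rw [← Real.rpow_sub hn']; norm_num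
  have hne : ∀ᶠ n : ℕ in atTop, n / 2 ≠ 0 := by
    filter_upwards [eventually_ge_atTop 2] with n hn using by omega
  have h := ENNReal.Tendsto.mul_const (b := meanLength + 1) (tendsto_natCast_div hne hr)
    (Or.inr (ENNReal.add_ne_top.2 ⟨meanLength_ne_top, ENNReal.one_ne_top⟩))
  rw [zero_mul] at h
  refine tendsto_of_tendsto_of_tendsto_of_le_of_le' tendsto_const_nhds h
    (Eventually.of_forall fun _ => zero_le) ?_
  filter_upwards [hne] with n hn
  exact lengthsLaw_sum_lt_le _ _ hn

lemma log_three_halves_le : Real.log (3 / 2) ≤ 0.42 := by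
  rw [Real.log_le_iff_le_exp (by norm_num)]
  have := Real.quadratic_le_exp_of_nonneg (show (0 : ℝ) ≤ 0.42 by norm_num)
  norm_num at this ⊢
  linarith

/-- A counter of length about `2 ln n` has frequency at least `n ^ (-0.84)`, up to a constant. -/
lemma le_pow_counterLength {n : ℕ} (hn : 0 < n) :
    2 / 3 * (n : ℝ) ^ (-(0.84 : ℝ)) ≤ (2 / 3 : ℝ) ^ counterLength n := by
  have hlog := Real.log_natCast_nonneg n
  have h1 : (counterLength n : ℝ) ≤ 2 * Real.log n + 1 :=
    (Nat.ceil_lt_add_one (by linarith)).le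
  have hn1 : (1 : ℝ) ≤ n := by exact_mod_cast hn
  rw [← Real.rpow_natCast]
  calc (2 / 3 : ℝ) * (n : ℝ) ^ (-(0.84 : ℝ)) ≤ 2 / 3 * (n : ℝ) ^ (2 * Real.log (2 / 3)) := by
        gcongr
        have : Real.log (2 / 3) = -Real.log (3 / 2) := by rw [← Real.log_inv]; norm_num
        have := log_three_halves_le
        linarith
    _ = (2 / 3 : ℝ) ^ (2 * Real.log n + 1) := by
        rw [Real.rpow_add (by norm_num), Real.rpow_one, rpow_log_eq (by norm_num) hn]; ring
    _ ≤ _ := Real.rpow_le_rpow_of_exponent_ge (by norm_num) (by norm_num) h1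

lemma tendsto_forall_ne :
    Tendsto (fun n : ℕ => lengthsLaw
      {l | ∀ j ∈ Finset.range (numCounters n), l (-((j : ℤ) + 1)) ≠ counterLength n})
      atTop (𝓝 0) := by
  have hgrow : Tendsto (fun n : ℕ => (lengthLaw (counterLength n)).toReal * numCounters n)
      atTop atTop := by
    have h1 : Tendsto (fun n : ℕ => 1 / 9 * (n : ℝ) ^ (0.06 : ℝ)) atTop atTop :=
      ((tendsto_rpow_atTop (by norm_num)).comp tendsto_natCast_atTop_atTop).const_mul_atTop
        (by norm_num)
    refine tendsto_atTop_mono' _ ?_ h1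
    have h2 : ∀ᶠ n : ℕ in atTop, (2 : ℝ) ≤ (n : ℝ) ^ (0.9 : ℝ) :=
      ((tendsto_rpow_atTop (by norm_num)).comp tendsto_natCast_atTop_atTop).eventually_ge_atTop 2
    filter_upwards [h2, tendsto_counterLength.eventually_ge_atTop 3, eventually_gt_atTop 0]
      with n hn2 hK hn
    have hn' : (0 : ℝ) < n := by exact_mod_cast hn
    have h3 : (n : ℝ) ^ (0.9 : ℝ) / 2 ≤ numCounters n := by
      have := Nat.lt_floor_add_one ((n : ℝ) ^ (0.9 : ℝ))
      unfold numCounters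
      linarith
    have h4 := (div_le_div_of_nonneg_right (le_pow_counterLength hn)
      (show (0 : ℝ) ≤ 3 by norm_num)).trans (le_lengthLaw hK)
    calc 1 / 9 * (n : ℝ) ^ (0.06 : ℝ)
        = 2 / 3 * (n : ℝ) ^ (-(0.84 : ℝ)) / 3 * ((n : ℝ) ^ (0.9 : ℝ) / 2) := by
          rw [show (0.06 : ℝ) = -0.84 + 0.9 by norm_num, Real.rpow_add hn']; ring
      _ ≤ _ := by gcongr
  have hexp : Tendsto (fun n : ℕ =>
      ENNReal.ofReal (Real.exp (-((lengthLaw (counterLength n)).toReal * numCounters n))))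
      atTop (𝓝 0) := by
    have := ENNReal.tendsto_ofReal (Real.tendsto_exp_neg_atTop_nhds_zero.comp hgrow)
    rwa [ENNReal.ofReal_zero] at this
  refine tendsto_of_tendsto_of_tendsto_of_le_of_le tendsto_const_nhds hexp
    (fun _ => zero_le) fun n => ?_
  rw [lengthsLaw_forall_ne]
  refine ENNReal.ofReal_le_ofReal ?_
  have hp : (lengthLaw (counterLength n)).toReal ≤ 1 :=
    ENNReal.toReal_le_of_le_ofReal zero_le_one (by simpa using PMF.coe_le_one _ _)
  calc (1 - (lengthLaw (counterLength n)).toReal) ^ numCounters n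
      ≤ Real.exp (-(lengthLaw (counterLength n)).toReal) ^ numCounters n := by
        exact pow_le_pow_left₀ (sub_nonneg.2 hp) (Real.one_sub_le_exp_neg _) _
    _ = _ := by rw [← Real.exp_nat_mul]; ring_nf

lemma tendsto_badLengths :
    Tendsto (fun n : ℕ => lengthsLaw
      (badLengths (counterLength n) (originLength n) (numCounters n) (n / 2))) atTop (𝓝 0) := by
  have h := (tendsto_lt_originLength.add tendsto_forall_ne).add tendsto_sum_lt
  rw [add_zero, add_zero] at h
  refine tendsto_of_tendsto_of_tendsto_of_le_of_le tendsto_const_nhds h (fun _ => zero_le)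
    fun n => ?_
  exact (measure_union_le _ _).trans (add_le_add_left (measure_union_le _ _) _)

lemma tendsto_carry_bound :
    Tendsto (fun n : ℕ => ((2 * delay n + 2 * counterLength n : ℕ) : ℝ≥0∞) / 2 ^ counterLength n)
      atTop (𝓝 0) := by
  have h1 : Tendsto (fun n : ℕ => 2 * ((2 : ℝ) ^ (-(0.5 * Real.log n)) +
      (2 : ℝ) ^ (-(2 * Real.log n)))) atTop (𝓝 0) := by
    have h2 : ∀ b : ℝ, 0 < b → Tendsto (fun n : ℕ => (2 : ℝ) ^ (-(b * Real.log n))) atTop (𝓝 0) := by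
      intro b hb
      have := (tendsto_rpow_atBot_of_base_gt_one 2 (by norm_num)).comp
        (tendsto_neg_atTop_atBot.comp (tendsto_log_natCast.const_mul_atTop hb))
      exact this
    simpa using ((h2 0.5 (by norm_num)).add (h2 2 (by norm_num))).const_mul 2
  have h2 : Tendsto (fun n : ℕ => 2 * ((counterLength n : ℝ) * (1 / 2) ^ counterLength n))
      atTop (𝓝 0) := by
    have := (tendsto_self_mul_const_pow_of_lt_one (show (0 : ℝ) ≤ 1 / 2 by norm_num)
      (by norm_num)).comp tendsto_counterLength
    simpa using this.const_mul 2
  have h3 : Tendsto (fun n : ℕ => ((2 * delay n + 2 * counterLength n : ℕ) : ℝ) /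
      ((2 ^ counterLength n : ℕ) : ℝ)) atTop (𝓝 0) := by
    have h := h1.add h2
    rw [add_zero] at h
    refine squeeze_zero (fun n => by positivity) (fun n => ?_) h
    have h4 : (delay n : ℝ) ≤ (2 : ℝ) ^ (1.5 * Real.log n) + 1 :=
      (Nat.ceil_lt_add_one (by positivity)).le
    have h5 : (2 : ℝ) ^ (2 * Real.log n) ≤ 2 ^ counterLength n := by
      rw [← Real.rpow_natCast]
      exact Real.rpow_le_rpow_of_exponent_le (by norm_num) (Nat.le_ceil _)
    push_cast
    rw [add_div, mul_div_assoc, mul_div_assoc]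
    gcongr ?_ + ?_
    · gcongr 2 * ?_
      calc (delay n : ℝ) / 2 ^ counterLength n
          ≤ ((2 : ℝ) ^ (1.5 * Real.log n) + 1) / (2 : ℝ) ^ (2 * Real.log n) := by gcongr
        _ = _ := by
          rw [add_div, ← Real.rpow_sub (by norm_num), one_div, ← Real.rpow_neg (by norm_num)]
          ring_nf
    · rw [one_div, inv_pow, div_eq_mul_inv]
  have h := tendsto_natCast_div (Eventually.of_forall fun n => by positivity) h3
  simpa using h

/-- The good event at scale `n`. -/
noncomputable def goodSetAt (n : ℕ) : Set Config :=
  goodSet n (counterLength n) (2 * delay n) (originLength n)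

lemma exists_bound_goodSetAt {e : ℕ} (he : e ≤ 1) : ∃ ε : ℕ → ℝ≥0∞, Tendsto ε atTop (𝓝 0) ∧
    ∀ᶠ n in atTop, ∀ μ : Measure Config, IsMuF e μ → μ (goodSetAt n)ᶜ ≤ ε n := by
  refine ⟨fun n => ((2 * delay n + 2 * counterLength n : ℕ) : ℝ≥0∞) / 2 ^ counterLength n +
      (meanLength + e)⁻¹ * ∫⁻ l in badLengths (counterLength n) (originLength n) (numCounters n)
        (n / 2), ((l 0 : ℝ≥0∞) + e) ∂lengthsLaw, ?_, ?_⟩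
  · have h1 : Tendsto (fun n : ℕ => ∫⁻ l in badLengths (counterLength n) (originLength n)
        (numCounters n) (n / 2), ((l 0 : ℝ≥0∞) + e) ∂lengthsLaw) atTop (𝓝 0) := by
      refine tendsto_setLIntegral_zero ?_ tendsto_badLengths
      rw [lintegral_length_add]
      exact ENNReal.add_ne_top.2 ⟨meanLength_ne_top, ENNReal.natCast_ne_top e⟩
    have h2 := ENNReal.Tendsto.const_mul (a := (meanLength + e)⁻¹) h1
      (Or.inr (ENNReal.inv_ne_top.2 fun h => meanLength_ne_zero (add_eq_zero.1 h).1))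
    simpa using tendsto_carry_bound.add h2
  · filter_upwards [eventually_add_le] with n hn μ hμ
    exact hμ.le (isClopen_goodSet _ _ _ _).compl fun k => muTilde_goodSet_compl_le he hn k

/-! ### Slow perturbations and vanishing exponents -/

/-- The exponent `1.5 ln 2 > 1` for which `2 ^ (1.5 ln n) = n ^ δ`. -/
noncomputable def crossExponent : ℝ := 1.5 * Real.log 2

lemma one_lt_crossExponent : 1 < crossExponent := by
  have := Real.log_two_gt_d9
  unfold crossExponent
  linarith

lemma rpow_crossExponent_le_delay {n : ℕ} (hn : 0 < n) : (n : ℝ) ^ crossExponent ≤ delay n := by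
  rw [crossExponent, ← rpow_log_eq (by norm_num) hn]
  exact Nat.le_ceil _

lemma delay_le_crossTime {n : ℕ} (hK : 0 < counterLength n) {x : Config} (hx : x ∈ Omega)
    (hg : x ∈ goodSetAt n) : (delay n : ℕ∞) ≤ crossTime F n x :=
  le_crossTime_of_mem_goodSet hK hx hg

lemma mem_slowSet_of_mem_goodSetAt {n : ℕ} {x : Config} (hx : x ∈ Omega)
    (hg : x ∈ goodSetAt n) : x ∈ slowSet n := by
  refine mem_slowSet_of_mem_goodSet hx hg (Nat.floor_le ?_) (Nat.le_ceil _) ?_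
  · have := Real.log_natCast_nonneg n
    linarith
  · have h : (2 : ℝ) ^ (1.5 * Real.log n) ≤ delay n := Nat.le_ceil _
    have h' : (0 : ℝ) ≤ delay n := Nat.cast_nonneg _
    push_cast
    linarith

lemma IsMuF.tendsto_slow {e : ℕ} (he : e ≤ 1) {μ : Measure Config} (hμ : IsMuF e μ) :
    Tendsto (fun n : ℕ => μ {x | x ∈ slowSet n ∧
      ENNReal.ofReal (1 * (n : ℝ) ^ crossExponent) ≤ (crossTime F n x : ℝ≥0∞)}) atTop (𝓝 1) := by
  have := hμ.1
  obtain ⟨ε, hε, hbound⟩ := exists_bound_goodSetAt he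
  have h1 : Tendsto (fun n => 1 - ε n) atTop (𝓝 1) := by
    simpa using ENNReal.Tendsto.sub (tendsto_const_nhds (x := (1 : ℝ≥0∞))) hε (by simp)
  refine tendsto_of_tendsto_of_tendsto_of_le_of_le' h1 tendsto_const_nhds ?_
    (Eventually.of_forall fun n => prob_le_one)
  filter_upwards [hbound, eventually_gt_atTop 0, tendsto_counterLength.eventually_gt_atTop 0]
    with n hn hn0 hK
  have hm : MeasurableSet (goodSetAt n) := (isClopen_goodSet _ _ _ _).isOpen.measurableSet
  calc 1 - ε n ≤ 1 - μ (goodSetAt n)ᶜ := tsub_le_tsub_left (hn μ hμ) 1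
    _ = μ (goodSetAt n) := by rw [← prob_compl_eq_one_sub hm.compl, compl_compl]
    _ ≤ _ := by
      refine measure_mono_ae ?_
      filter_upwards [hμ.ae_omega he] with x hx hg
      refine ⟨mem_slowSet_of_mem_goodSetAt hx hg, ?_⟩
      rw [one_mul]
      calc ENNReal.ofReal ((n : ℝ) ^ crossExponent) ≤ ENNReal.ofReal (delay n) :=
            ENNReal.ofReal_le_ofReal (rpow_crossExponent_le_delay hn0)
        _ = ((delay n : ℕ∞) : ℝ≥0∞) := by simp
        _ ≤ _ := ENat.toENNReal_le.2 (delay_le_crossTime hK hx hg)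

lemma tendsto_div_delay :
    Tendsto (fun n : ℕ => (n : ℝ≥0∞) / ((delay n - 1 : ℕ) : ℝ≥0∞)) atTop (𝓝 0) ∧
      Tendsto (fun n => delay n - 1) atTop atTop := by
  have hδ := one_lt_crossExponent
  have hpow : Tendsto (fun n : ℕ => (n : ℝ) ^ crossExponent) atTop atTop :=
    (tendsto_rpow_atTop (by linarith)).comp tendsto_natCast_atTop_atTop
  have hle : ∀ᶠ n : ℕ in atTop, (n : ℝ) ^ crossExponent / 2 ≤ ((delay n - 1 : ℕ) : ℝ) := by
    filter_upwards [hpow.eventually_ge_atTop 2, eventually_gt_atTop 0] with n h2 hn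
    have h := rpow_crossExponent_le_delay hn
    have h1 : (delay n : ℝ) ≤ ((delay n - 1 : ℕ) : ℝ) + 1 := by
      exact_mod_cast (by omega : delay n ≤ delay n - 1 + 1)
    linarith
  have hatTop : Tendsto (fun n => delay n - 1) atTop atTop :=
    tendsto_natCast_atTop_iff (R := ℝ).1
      (tendsto_atTop_mono' _ hle (hpow.atTop_div_const (by norm_num)))
  refine ⟨tendsto_natCast_div (hatTop.eventually_ne_atTop 0) ?_, hatTop⟩
  have h1 : Tendsto (fun n : ℕ => 2 * (n : ℝ) ^ (-(crossExponent - 1))) atTop (𝓝 0) := by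
    simpa using ((tendsto_rpow_neg_atTop (sub_pos.2 hδ)).comp
      tendsto_natCast_atTop_atTop).const_mul 2
  refine squeeze_zero' (Eventually.of_forall fun n => by positivity) ?_ h1
  filter_upwards [hle, eventually_gt_atTop 0] with n hn hn0
  have hn' : (0 : ℝ) < n := by exact_mod_cast hn0
  calc (n : ℝ) / ((delay n - 1 : ℕ) : ℝ) ≤ n / ((n : ℝ) ^ crossExponent / 2) := by gcongr
    _ = 2 * ((n : ℝ) ^ (1 : ℝ) / (n : ℝ) ^ crossExponent) := by rw [Real.rpow_one]; field_simp
    _ = _ := by rw [← Real.rpow_sub hn']; ring_nf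

/-- In `delay n - 1` steps, which is much more than `n`, perturbations cross at most `n` sites,
except on an event of small probability where they are at most twice as many as the steps. -/
lemma IsMuF.avgPlus_eq_zero {e : ℕ} (he : e ≤ 1) {μ : Measure Config} (hμ : IsMuF e μ) :
    avgPlus F μ = 0 := by
  have := hμ.1
  obtain ⟨ε, hε, hbound⟩ := exists_bound_goodSetAt he
  obtain ⟨hdiv, hatTop⟩ := tendsto_div_delay
  set u : ℕ → ℝ≥0∞ := fun n => (∫⁻ x, (speedPlus F n x : ℝ≥0∞) ∂μ) / (n : ℝ≥0∞) with hu
  have hlim : Tendsto (fun n => u (delay n - 1)) atTop (𝓝 0) := by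
    have h := hdiv.add (ENNReal.Tendsto.const_mul (a := 5) hε (Or.inr (by simp)))
    rw [mul_zero, add_zero] at h
    refine tendsto_of_tendsto_of_tendsto_of_le_of_le' tendsto_const_nhds h
      (Eventually.of_forall fun _ => zero_le) ?_
    filter_upwards [hbound, hatTop.eventually_gt_atTop 0,
      tendsto_counterLength.eventually_gt_atTop 0] with n hn hm hK
    set m := delay n - 1 with hmdef
    have hGm : MeasurableSet (goodSetAt n)ᶜ :=
      (isClopen_goodSet _ _ _ _).isOpen.measurableSet.compl
    have hpt : ∀ᵐ x ∂μ, (speedPlus F m x : ℝ≥0∞) ≤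
        n + (goodSetAt n)ᶜ.indicator (fun _ => (5 * m : ℝ≥0∞)) x := by
      filter_upwards [hμ.ae_omega he] with x hx
      by_cases hg : x ∈ goodSetAt n
      · have hlt : (m : ℕ∞) < crossTime F n x :=
          lt_of_lt_of_le (by exact_mod_cast (by omega : m < delay n)) (delay_le_crossTime hK hx hg)
        refine le_add_right ?_
        simpa using ENat.toENNReal_le.2 (speedPlus_le_of_lt_crossTime hlt)
      · rw [Set.indicator_of_mem hg]
        refine le_add_left ((ENat.toENNReal_le.2 (speedPlus_le m x)).trans ?_)
        have : ((2 * m + 3 : ℕ) : ℝ≥0∞) ≤ ((5 * m : ℕ) : ℝ≥0∞) := by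
          exact_mod_cast (by omega : 2 * m + 3 ≤ 5 * m)
        simpa using this
    have hint : ∫⁻ x, (speedPlus F m x : ℝ≥0∞) ∂μ ≤ n + 5 * m * ε n := by
      refine (lintegral_mono_ae hpt).trans ?_
      rw [lintegral_add_left measurable_const, lintegral_const, measure_univ, mul_one,
        lintegral_indicator_const hGm]
      gcongr
      exact hn μ hμ
    have hm0 : (m : ℝ≥0∞) ≠ 0 := by simpa using hm.ne'
    calc u m ≤ (n + 5 * m * ε n) / m := ENNReal.div_le_div_right hint _
      _ = n / m + 5 * ε n := by
        rw [ENNReal.add_div, show 5 * (m : ℝ≥0∞) * ε n = 5 * ε n * m by ring,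
          ENNReal.mul_div_cancel_right hm0 (ENNReal.natCast_ne_top m)]
  refine le_antisymm ?_ zero_le
  calc avgPlus F μ = liminf u atTop := rfl
    _ ≤ liminf u (map (fun n => delay n - 1) atTop) := liminf_le_liminf_of_le hatTop
    _ = 0 := hlim.liminf_eq

lemma avgMinus_eq_zero (μ : Measure Config) [IsProbabilityMeasure μ] : avgMinus F μ = 0 := by
  have hlim : Tendsto (fun n : ℕ => (3 : ℝ≥0∞) / n) atTop (𝓝 0) := by
    simpa using ENNReal.Tendsto.const_div (a := 3) ENNReal.tendsto_nat_nhds_top (Or.inr (by simp))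
  refine Tendsto.liminf_eq (tendsto_of_tendsto_of_tendsto_of_le_of_le tendsto_const_nhds hlim
    (fun _ => zero_le) fun n => ENNReal.div_le_div_right ?_ _)
  calc ∫⁻ x, (speedMinus F n x : ℝ≥0∞) ∂μ ≤ ∫⁻ _, 3 ∂μ :=
        lintegral_mono fun x => by simpa using ENat.toENNReal_le.2 (speedMinus_le n x)
    _ = 3 := by simp

end CounterCA

theorem mainTheorem4 (e : ℕ) (he : e ≤ 1) :
    (∃ μ : Measure CounterCA.Config, CounterCA.IsMuF e μ) ∧
    ∃ c : ℝ, 0 < c ∧ ∃ δ : ℝ, 1 < δ ∧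
      ∀ μ : Measure CounterCA.Config, CounterCA.IsMuF e μ →
        CellularLyapunov.avgPlus CounterCA.F μ + CellularLyapunov.avgMinus CounterCA.F μ = 0 ∧
        Tendsto (fun n : ℕ => μ {x | x ∈ CounterCA.slowSet n ∧
            ENNReal.ofReal (c * (n : ℝ) ^ δ) ≤
              (CellularLyapunov.crossTime CounterCA.F n x : ℝ≥0∞)})
          atTop (𝓝 1) := by
  refine ⟨CounterCA.exists_isMuF he, 1, one_pos, CounterCA.crossExponent,
    CounterCA.one_lt_crossExponent, fun μ hμ => ⟨?_, hμ.tendsto_slow he⟩⟩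
  have := hμ.1
  rw [hμ.avgPlus_eq_zero he, CounterCA.avgMinus_eq_zero μ, add_zero]
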